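/- Let $z\in\mathbb{C}$ and $b>0$. Let $\langle f,g\rangle=\int_{\mathbb{R}} f\overline{g}\,dx$ on $L^2(\mathbb{R})$, and on the form domain $\mathcal{D}=\{f\in H^1(\mathbb{R}) : xf(x)\in L^2(\mathbb{R})\}$ consider $$t_{z,b}(f,g)=\langle f',g'\rangle+\tfrac14\langle xf,xg\rangle-\tfrac12\langle f,g\rangle+z\big(f(b)\overline{g(b)}-f(-b)\overline{g(-b)}\big),$$ where $f(\pm b)$, $g(\pm b)$ are the values of the continuous representatives. Let $L_{z,b}$ be the operator $$L_{z,b}\,y=-y''+\Big(\frac{x^2}{4}-\frac12\Big)y+z\big(\delta(x-b)-\delta(x+b)\big)y$$ on $L^2(\mathbb{R})$ associated with this form: $f$ lies in the domain of $L_{z,b}$ with $L_{z,b}f=h$ if and only if $f\in\mathcal{D}$, $h\in L^2(\mathbb{R})$ and $t_{z,b}(f,g)=\langle h,g\rangle$ for all $g\in\mathcal{D}$. For $\nu,x\in\mathbb{C}$ let $$y_{\mathrm{even}}(\nu,x)=e^{-x^2/4}\sum_{k\ge 0}\Big(\prod_{j=0}^{k-1}(-\nu+2j)\Big)\frac{x^{2k}}{(2k)!},\qquad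 y_{\mathrm{odd}}(\nu,x)=e^{-x^2/4}\sum_{k\ge 0}\Big(\prod_{j=0}^{k-1}(-\nu+1+2j)\Big)\frac{x^{2k+1}}{(2k+1)!}$$ be the even and odd solutions of $-y''+(x^2/4-1/2)y=\nu y$, and let $$D_\nu(x)=\frac{2^{\nu/2}\sqrt{\pi}}{\Gamma(\frac12-\frac{\nu}{2})}\,y_{\mathrm{even}}(\nu,x)-\frac{2^{(\nu+1)/2}\sqrt{\pi}}{\Gamma(-\frac{\nu}{2})}\,y_{\mathrm{odd}}(\nu,x)$$ be the parabolic cylinder function; here $1/\Gamma$ is the entire reciprocal Gamma function, which vanishes at $0,-1,-2,\dots$. Then, for every $\nu\in\mathbb{C}$, $\nu$ belongs to the spectrum of $L_{z,b}$ if and only if $$\frac{\sqrt{\pi}}{\sqrt{2}\,\Gamma(-\nu)}-z^2\,D_\nu(b)^2\,y_{\mathrm{even}}(\nu,b)\,y_{\mathrm{odd}}(\nu,b)=0.$$ -/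

import Mathlib

open MeasureTheory
open scoped ContDiff ComplexConjugate

namespace OddPair

noncomputable section

/-! ### Parabolic cylinder functions -/

/-- The even solution
`exp(-x²/4) (1 + (-ν) x²/2! + (-ν)(-ν+2) x⁴/4! + ⋯)` of `-y'' + (x²/4 - 1/2) y = ν y`. -/
def yEven (ν x : ℂ) : ℂ :=
  Complex.exp (-x ^ 2 / 4) *
    ∑' k : ℕ, (∏ j ∈ Finset.range k, (-ν + 2 * (j : ℂ))) * x ^ (2 * k) / ((2 * k).factorial : ℂ)

/-- The odd solution
`exp(-x²/4) (x + (-ν+1) x³/3! + (-ν+1)(-ν+3) x⁵/5! + ⋯)` of `-y'' + (x²/4 - 1/2) y = ν y`. -/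
def yOdd (ν x : ℂ) : ℂ :=
  Complex.exp (-x ^ 2 / 4) *
    ∑' k : ℕ, (∏ j ∈ Finset.range k, (-ν + 1 + 2 * (j : ℂ))) * x ^ (2 * k + 1) /
      ((2 * k + 1).factorial : ℂ)

/-- The entire function `1 / Γ`. Mathlib's `Γ` takes the value `0` at its poles, so that the
inverse vanishes there. -/
def recipGamma (s : ℂ) : ℂ := (Complex.Gamma s)⁻¹

/-- The parabolic cylinder function `D_ν`: the solution of `-y'' + (x²/4 - 1/2) y = ν y` with
`D_ν(0) = 2^{ν/2} √π / Γ(1/2 - ν/2)` and `D_ν'(0) = -2^{(ν+1)/2} √π / Γ(-ν/2)`. -/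
def parabolicD (ν x : ℂ) : ℂ :=
  (2 : ℂ) ^ (ν / 2) * (√Real.pi : ℂ) * recipGamma (-ν / 2 + 1 / 2) * yEven ν x -
    (2 : ℂ) ^ ((ν + 1) / 2) * (√Real.pi : ℂ) * recipGamma (-ν / 2) * yOdd ν x

/-! ### The spectrum of an unbounded operator -/

/-- The resolvent set of an unbounded operator `A` on `E`: those `ν` for which `A - ν` is a
bijection from its domain onto `E` with bounded inverse `R`. -/
def resolventSet {E : Type*} [NormedAddCommGroup E] [NormedSpace ℂ E] (A : E →ₗ.[ℂ] E) : Set ℂ :=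
  {ν | ∃ R : E →L[ℂ] E,
    (∀ h : E, ∃ hR : R h ∈ A.domain, A ⟨R h, hR⟩ - ν • R h = h) ∧
    (∀ f : A.domain, R (A f - ν • (f : E)) = f)}

/-- The spectrum of an unbounded operator. -/
def opSpectrum {E : Type*} [NormedAddCommGroup E] [NormedSpace ℂ E] (A : E →ₗ.[ℂ] E) : Set ℂ :=
  (resolventSet A)ᶜ

/-! ### The Sobolev space `H¹(ℝ)` and the form domain -/

/-- The Hilbert space `L²(ℝ)` of complex valued functions. -/
abbrev L2 : Type := Lp ℂ 2 (volume : Measure ℝ)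

/-- `g ∈ L²(ℝ)` is the weak derivative of `f ∈ L²(ℝ)`. -/
def HasWeakDeriv (f g : L2) : Prop :=
  ∀ φ : ℝ → ℝ, ContDiff ℝ ∞ φ → HasCompactSupport φ →
    ∫ x, deriv φ x • f x = -∫ x, φ x • g x

theorem L2.locallyIntegrable (f : L2) : LocallyIntegrable f volume :=
  (Lp.memLp f).locallyIntegrable (by norm_num)

theorem L2.integrable_smul (f : L2) {φ : ℝ → ℝ} (hφ : Continuous φ) (hc : HasCompactSupport φ) :
    Integrable (fun x => φ x • f x) :=
  (L2.locallyIntegrable f).integrable_smul_left_of_hasCompactSupport hφ hc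

theorem continuous_deriv_of_smooth {φ : ℝ → ℝ} (hφ : ContDiff ℝ ∞ φ) : Continuous (deriv φ) :=
  hφ.continuous_deriv (by simp)

theorem HasWeakDeriv.unique {f g g₁ : L2} (h : HasWeakDeriv f g) (h₁ : HasWeakDeriv f g₁) :
    g = g₁ := by
  apply Lp.ext
  refine ae_eq_of_integral_contDiff_smul_eq (L2.locallyIntegrable g) (L2.locallyIntegrable g₁) ?_
  intro φ hφ hc
  exact neg_injective ((h φ hφ hc).symm.trans (h₁ φ hφ hc))

theorem HasWeakDeriv.add {f g f₁ g₁ : L2} (h : HasWeakDeriv f g) (h₁ : HasWeakDeriv f₁ g₁) :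
    HasWeakDeriv (f + f₁) (g + g₁) := by
  intro φ hφ hc
  have e1 : ∫ x, deriv φ x • (f + f₁) x = ∫ x, (deriv φ x • f x + deriv φ x • f₁ x) := by
    apply integral_congr_ae
    filter_upwards [Lp.coeFn_add f f₁] with x hx
    rw [hx, Pi.add_apply, smul_add]
  have e2 : ∫ x, φ x • (g + g₁) x = ∫ x, (φ x • g x + φ x • g₁ x) := by
    apply integral_congr_ae
    filter_upwards [Lp.coeFn_add g g₁] with x hx
    rw [hx, Pi.add_apply, smul_add]
  have hd := continuous_deriv_of_smooth hφ
  rw [e1, e2, integral_add (L2.integrable_smul f hd hc.deriv) (L2.integrable_smul f₁ hd hc.deriv),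
    integral_add (L2.integrable_smul g hφ.continuous hc) (L2.integrable_smul g₁ hφ.continuous hc),
    h φ hφ hc, h₁ φ hφ hc]
  ring

theorem HasWeakDeriv.smul (c : ℂ) {f g : L2} (h : HasWeakDeriv f g) :
    HasWeakDeriv (c • f) (c • g) := by
  intro φ hφ hc
  have e1 : ∫ x, deriv φ x • (c • f) x = ∫ x, c • (deriv φ x • f x) := by
    apply integral_congr_ae
    filter_upwards [Lp.coeFn_smul c f] with x hx
    rw [hx, Pi.smul_apply, smul_comm]
  have e2 : ∫ x, φ x • (c • g) x = ∫ x, c • (φ x • g x) := by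
    apply integral_congr_ae
    filter_upwards [Lp.coeFn_smul c g] with x hx
    rw [hx, Pi.smul_apply, smul_comm]
  rw [e1, e2, integral_smul, integral_smul, h φ hφ hc, smul_neg]

theorem hasWeakDeriv_zero : HasWeakDeriv 0 0 := by
  simpa using HasWeakDeriv.smul 0 (f := 0) (g := 0) (by
    intro φ hφ hc
    have e : ∀ ψ : ℝ → ℝ, ∫ x, ψ x • (0 : L2) x = 0 := by
      intro ψ
      rw [← integral_zero ℝ ℂ (μ := volume)]
      apply integral_congr_ae
      filter_upwards [Lp.coeFn_zero ℂ 2 (volume : Measure ℝ)] with x hx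
      rw [hx]; simp
    rw [e, e, neg_zero])

/-- The Sobolev space `H¹(ℝ)`. -/
def sobolevH1 : Submodule ℂ L2 where
  carrier := {f | ∃ g : L2, HasWeakDeriv f g}
  zero_mem' := ⟨0, hasWeakDeriv_zero⟩
  add_mem' := by
    rintro f f₁ ⟨g, hg⟩ ⟨g₁, hg₁⟩
    exact ⟨g + g₁, hg.add hg₁⟩
  smul_mem' := by
    rintro c f ⟨g, hg⟩
    exact ⟨c • g, hg.smul c⟩

/-- The form domain `{f ∈ H¹(ℝ) : x f(x) ∈ L²(ℝ)}`. -/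
def formDomain : Submodule ℂ L2 where
  carrier := {f | f ∈ sobolevH1 ∧ MemLp (fun x : ℝ => (x : ℂ) * f x) 2 volume}
  zero_mem' := by
    refine ⟨sobolevH1.zero_mem, (MemLp.zero' (ε := ℂ)).ae_eq ?_⟩
    filter_upwards [Lp.coeFn_zero ℂ 2 (volume : Measure ℝ)] with x hx
    rw [hx]; simp
  add_mem' := by
    rintro f f₁ ⟨h, hm⟩ ⟨h₁, hm₁⟩
    refine ⟨sobolevH1.add_mem h h₁, (hm.add hm₁).ae_eq ?_⟩
    filter_upwards [Lp.coeFn_add f f₁] with x hx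
    rw [hx]; simp [mul_add]
  smul_mem' := by
    rintro c f ⟨h, hm⟩
    refine ⟨sobolevH1.smul_mem c h, (hm.const_smul c).ae_eq ?_⟩
    filter_upwards [Lp.coeFn_smul c f] with x hx
    rw [hx]; simp [mul_left_comm]

open Classical in
/-- The weak derivative `f'` of `f ∈ H¹(ℝ)` (and `0` for other `f`). -/
def weakDeriv (f : L2) : L2 :=
  if h : ∃ g : L2, HasWeakDeriv f g then h.choose else 0

theorem HasWeakDeriv.weakDeriv_eq {f g : L2} (h : HasWeakDeriv f g) : weakDeriv f = g := by
  have hex : ∃ g : L2, HasWeakDeriv f g := ⟨g, h⟩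
  rw [weakDeriv, dif_pos hex]
  exact hex.choose_spec.unique h

theorem hasWeakDeriv_weakDeriv {f : L2} (h : f ∈ sobolevH1) : HasWeakDeriv f (weakDeriv f) := by
  obtain ⟨g, hg⟩ := h
  rwa [hg.weakDeriv_eq]

open Classical in
/-- The continuous representative of `f ∈ H¹(ℝ)` (and `0` if `f` has none). -/
def contRep (f : L2) : ℝ → ℂ :=
  if h : ∃ u : ℝ → ℂ, Continuous u ∧ f =ᵐ[volume] u then h.choose else 0

theorem contRep_eq {f : L2} {u : ℝ → ℂ} (hu : Continuous u) (h : f =ᵐ[volume] u) :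
    contRep f = u := by
  have hex : ∃ u : ℝ → ℂ, Continuous u ∧ f =ᵐ[volume] u := ⟨u, hu, h⟩
  rw [contRep, dif_pos hex]
  exact (Continuous.ae_eq_iff_eq volume hex.choose_spec.1 hu).1 (hex.choose_spec.2.symm.trans h)

/-- Integration by parts against a primitive, real valued case. -/
theorem integral_deriv_mul_primitive {g φ : ℝ → ℝ} (hg : LocallyIntegrable g volume)
    (hφ : ContDiff ℝ ∞ φ) (hc : HasCompactSupport φ) :
    ∫ x, deriv φ x * (∫ t in (0 : ℝ)..x, g t) = -∫ x, φ x * g x := by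
  obtain ⟨M, hM0, hM⟩ : ∃ M : ℝ, 0 < M ∧ tsupport φ ⊆ Set.Ioo (-M) M := by
    obtain ⟨M, hM0, hM⟩ := hc.isCompact.isBounded.subset_ball_lt 0 0
    refine ⟨M, hM0, hM.trans ?_⟩
    rw [Real.ball_eq_Ioo]; simp
  have hMM : Set.Ioo (-M) M ⊆ Set.Ioc (-M) M := Set.Ioo_subset_Ioc_self
  have s1 : Function.support (fun x => deriv φ x * (∫ t in (0 : ℝ)..x, g t)) ⊆ Set.Ioc (-M) M := by
    refine (Function.support_mul_subset_left _ _).trans ?_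
    exact (support_deriv_subset.trans hM).trans hMM
  have s2 : Function.support (fun x => φ x * g x) ⊆ Set.Ioc (-M) M := by
    refine (Function.support_mul_subset_left _ _).trans ?_
    exact ((subset_tsupport φ).trans hM).trans hMM
  have z1 : φ M = 0 := by
    by_contra h
    exact lt_irrefl _ (hM (subset_tsupport φ h)).2
  have z2 : φ (-M) = 0 := by
    by_contra h
    exact lt_irrefl _ (hM (subset_tsupport φ h)).1
  rw [← intervalIntegral.integral_eq_integral_of_support_subset s1,
    ← intervalIntegral.integral_eq_integral_of_support_subset s2]
  have hi : IntervalIntegrable g volume (-M) M := (hg.integrableOn_isCompact isCompact_uIcc).intervalIntegrable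
  have hU := hi.absolutelyContinuousOnInterval_intervalIntegral (c := 0)
    (by rw [Set.uIcc_of_le (by linarith)]; constructor <;> linarith)
  have hφa : AbsolutelyContinuousOnInterval φ (-M) M :=
    (hφ.of_le (by simp)).contDiffOn.absolutelyContinuousOnInterval
  have key := hU.integral_mul_deriv_eq_deriv_mul hφa
  simp only [z1, z2, mul_zero, sub_zero, zero_sub] at key
  simp_rw [mul_comm (deriv φ _)]
  rw [key]
  congr 1
  apply intervalIntegral.integral_congr_ae
  filter_upwards [LocallyIntegrable.ae_hasDerivAt_integral hg] with x hx _
  rw [(hx 0).deriv, mul_comm]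

theorem integral_deriv_smul_primitive {g : ℝ → ℂ} {φ : ℝ → ℝ} (hg : LocallyIntegrable g volume)
    (hφ : ContDiff ℝ ∞ φ) (hc : HasCompactSupport φ) :
    ∫ x, deriv φ x • (∫ t in (0 : ℝ)..x, g t) = -∫ x, φ x • g x := by
  have hu : Continuous (fun x => ∫ t in (0 : ℝ)..x, g t) :=
    intervalIntegral.continuous_primitive (fun a b => (hg.integrableOn_isCompact isCompact_uIcc).intervalIntegrable) 0
  have i1 : Integrable (fun x => deriv φ x • (∫ t in (0 : ℝ)..x, g t)) :=
    ((continuous_deriv_of_smooth hφ).smul hu).integrable_of_hasCompactSupport hc.deriv.smul_right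
  have i2 : Integrable (fun x => φ x • g x) :=
    hg.integrable_smul_left_of_hasCompactSupport hφ.continuous hc
  have gen : ∀ L : ℂ →L[ℝ] ℝ, L (∫ x, deriv φ x • (∫ t in (0 : ℝ)..x, g t)) =
      L (-∫ x, φ x • g x) := by
    intro L
    have hLg : LocallyIntegrable (fun x => L (g x)) volume := by
      intro x
      obtain ⟨s, hs, hgs⟩ := hg x
      exact ⟨s, hs, L.integrable_comp hgs⟩
    rw [map_neg, ← L.integral_comp_comm i1, ← L.integral_comp_comm i2]
    simp only [map_smul, smul_eq_mul]
    rw [← integral_deriv_mul_primitive hLg hφ hc]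
    congr 1
    ext x
    rw [L.intervalIntegral_comp_comm (hg.integrableOn_isCompact isCompact_uIcc).intervalIntegrable]
  apply Complex.ext
  · exact gen Complex.reCLM
  · exact gen Complex.imCLM

/-- A locally integrable function with zero weak derivative is almost everywhere constant. -/
theorem ae_const_of_weakDeriv_zero {v : ℝ → ℂ} (hv : LocallyIntegrable v volume)
    (h : ∀ φ : ℝ → ℝ, ContDiff ℝ ∞ φ → HasCompactSupport φ → ∫ x, deriv φ x • v x = 0) :
    ∃ c : ℂ, v =ᵐ[volume] fun _ => c := by
  let β : ContDiffBump (0 : ℝ) := default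
  let ψ : ℝ → ℝ := β.normed volume
  have hψ : ContDiff ℝ ∞ ψ := β.contDiff_normed
  have hψc : HasCompactSupport ψ := β.hasCompactSupport_normed
  have hψi : ∫ x, ψ x = 1 := β.integral_normed
  refine ⟨∫ x, ψ x • v x, ?_⟩
  refine ae_eq_of_integral_contDiff_smul_eq hv (locallyIntegrable_const _) ?_
  intro φ hφ hc
  let m : ℝ := ∫ x, φ x
  let η : ℝ → ℝ := fun x => φ x - m * ψ x
  have hη : ContDiff ℝ ∞ η := hφ.sub (contDiff_const.mul hψ)
  have hηc : HasCompactSupport η := hc.sub hψc.mul_left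
  have iφ : Integrable φ := hφ.continuous.integrable_of_hasCompactSupport hc
  have iψ : Integrable ψ := hψ.continuous.integrable_of_hasCompactSupport hψc
  have iη : Integrable η := hη.continuous.integrable_of_hasCompactSupport hηc
  have hη0 : ∫ x, η x = 0 := by
    change ∫ x, (φ x - m * ψ x) = 0
    rw [integral_sub iφ (iψ.const_mul m), integral_const_mul, hψi]
    simp [m]
  obtain ⟨M, hM0, hM⟩ : ∃ M : ℝ, 0 < M ∧ tsupport η ⊆ Set.Ioo (-M) M := by
    obtain ⟨M, hM0, hM⟩ := hηc.isCompact.isBounded.subset_ball_lt 0 0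
    refine ⟨M, hM0, hM.trans ?_⟩
    rw [Real.ball_eq_Ioo]; simp
  let H : ℝ → ℝ := fun x => ∫ t in (-M)..x, η t
  have hHd : ∀ x, HasDerivAt H (η x) x := fun x =>
    intervalIntegral.integral_hasDerivAt_right (hη.continuous.intervalIntegrable _ _)
      (hη.continuous.stronglyMeasurableAtFilter _ _) hη.continuous.continuousAt
  have hder : deriv H = η := funext fun x => (hHd x).deriv
  have hH : ContDiff ℝ ∞ H := by
    rw [contDiff_infty_iff_deriv]
    exact ⟨fun x => (hHd x).differentiableAt, by rwa [hder]⟩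
  have hHc : HasCompactSupport H := by
    refine HasCompactSupport.intro (isCompact_Icc (a := -M) (b := M)) ?_
    intro x hx
    have zero_of : ∀ t, t ∉ Set.Ioo (-M) M → η t = 0 := fun t ht => by
      by_contra h0
      exact ht (hM (subset_tsupport η h0))
    rcases lt_or_ge x (-M) with hlt | hge
    · change ∫ t in (-M)..x, η t = 0
      rw [intervalIntegral.integral_congr (g := fun _ => (0 : ℝ))]
      · simp
      · intro t ht
        rw [Set.uIcc_of_ge hlt.le] at ht
        exact zero_of t (fun h' => absurd h'.1 (not_lt.2 ht.2))
    · have hgt : M < x := by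
        by_contra hle
        exact hx ⟨hge, not_lt.1 hle⟩
      change ∫ t in (-M)..x, η t = 0
      rw [intervalIntegral.integral_eq_integral_of_support_subset, hη0]
      intro t ht
      have := hM (subset_tsupport η ht)
      exact ⟨this.1, by linarith [this.2]⟩
  have key := h H hH hHc
  rw [hder] at key
  have j1 : Integrable (fun x => φ x • v x) :=
    hv.integrable_smul_left_of_hasCompactSupport hφ.continuous hc
  have j2 : Integrable (fun x => ψ x • v x) :=
    hv.integrable_smul_left_of_hasCompactSupport hψ.continuous hψc
  have e : ∀ x, η x • v x = φ x • v x - m • (ψ x • v x) := fun x => by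
    simp only [η, sub_smul, mul_smul]
  simp_rw [e] at key
  have j3 : Integrable (fun x => m • (ψ x • v x)) := j2.smul m
  rw [integral_sub j1 j3, integral_smul] at key
  rw [integral_smul_const]
  exact sub_eq_zero.1 key

/-- Every `f ∈ H¹(ℝ)` has a continuous representative. -/
theorem exists_contRep {f : L2} (h : f ∈ sobolevH1) :
    ∃ u : ℝ → ℂ, Continuous u ∧ f =ᵐ[volume] u := by
  obtain ⟨g, hg⟩ := h
  have hgl := L2.locallyIntegrable g
  have hu : Continuous (fun x => ∫ t in (0 : ℝ)..x, g t) :=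
    intervalIntegral.continuous_primitive (fun a b => (hgl.integrableOn_isCompact isCompact_uIcc).intervalIntegrable) 0
  obtain ⟨c, hc⟩ := ae_const_of_weakDeriv_zero
    (v := fun x => f x - ∫ t in (0 : ℝ)..x, g t)
    ((L2.locallyIntegrable f).sub hu.locallyIntegrable) (by
      intro φ hφ hc
      have hd := continuous_deriv_of_smooth hφ
      have j : Integrable (fun x => deriv φ x • (∫ t in (0 : ℝ)..x, g t)) :=
        (hd.smul hu).integrable_of_hasCompactSupport hc.deriv.smul_right
      simp_rw [smul_sub]
      rw [integral_sub (L2.integrable_smul f hd hc.deriv) j, hg φ hφ hc,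
        integral_deriv_smul_primitive hgl hφ hc, sub_self])
  refine ⟨fun x => c + ∫ t in (0 : ℝ)..x, g t, continuous_const.add hu, ?_⟩
  filter_upwards [hc] with x hx
  rw [← hx]; ring

theorem contRep_spec {f : L2} (h : f ∈ sobolevH1) :
    Continuous (contRep f) ∧ f =ᵐ[volume] contRep f := by
  obtain ⟨u, hu, hfu⟩ := exists_contRep h
  rw [contRep_eq hu hfu]
  exact ⟨hu, hfu⟩

/-! ### The form and the operator -/

/-- The sesquilinear form
`t(f, g) = ⟨f', g'⟩ + (1/4) ⟨x f, x g⟩ - (1/2) ⟨f, g⟩ + z (f(b) conj g(b) - f(-b) conj g(-b))`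
with `⟨f, g⟩ = ∫ f conj g`. Mathlib's inner product is conjugate linear in its first argument,
so that `⟨f, g⟩` is `inner ℂ g f`. -/
def form (z : ℂ) (b : ℝ) (f g : L2) : ℂ :=
  inner ℂ (weakDeriv g) (weakDeriv f)
    + 1 / 4 * (∫ x : ℝ, ((x : ℂ) * f x) * conj ((x : ℂ) * g x))
    - 1 / 2 * inner ℂ g f
    + z * (contRep f b * conj (contRep g b) - contRep f (-b) * conj (contRep g (-b)))

theorem integrable_weight {f g : L2} (hf : f ∈ formDomain) (hg : g ∈ formDomain) :
    Integrable (fun x : ℝ => ((x : ℂ) * f x) * conj ((x : ℂ) * g x)) :=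
  MemLp.integrable_mul hf.2 hg.2.star

theorem form_add (z : ℂ) (b : ℝ) {f f₁ g : L2} (hf : f ∈ formDomain) (hf₁ : f₁ ∈ formDomain)
    (hg : g ∈ formDomain) : form z b (f + f₁) g = form z b f g + form z b f₁ g := by
  have w := ((hasWeakDeriv_weakDeriv hf.1).add (hasWeakDeriv_weakDeriv hf₁.1)).weakDeriv_eq
  have hc := contRep_spec hf.1
  have hc₁ := contRep_spec hf₁.1
  have c : contRep (f + f₁) = contRep f + contRep f₁ :=
    contRep_eq (hc.1.add hc₁.1) ((Lp.coeFn_add f f₁).trans (hc.2.add hc₁.2))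
  have i : ∫ x : ℝ, ((x : ℂ) * (f + f₁) x) * conj ((x : ℂ) * g x) =
      ∫ x : ℝ, (((x : ℂ) * f x) * conj ((x : ℂ) * g x) +
        ((x : ℂ) * f₁ x) * conj ((x : ℂ) * g x)) := by
    apply integral_congr_ae
    filter_upwards [Lp.coeFn_add f f₁] with x hx
    rw [hx, Pi.add_apply]; ring
  rw [form, w, c, i, integral_add (integrable_weight hf hg) (integrable_weight hf₁ hg),
    inner_add_right, inner_add_right, form, form, Pi.add_apply, Pi.add_apply]
  ring

theorem form_smul (z : ℂ) (b : ℝ) (a : ℂ) {f g : L2} (hf : f ∈ formDomain) :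
    form z b (a • f) g = a * form z b f g := by
  have w := ((hasWeakDeriv_weakDeriv hf.1).smul a).weakDeriv_eq
  have hc := contRep_spec hf.1
  have c : contRep (a • f) = a • contRep f :=
    contRep_eq (hc.1.const_smul a) ((Lp.coeFn_smul a f).trans (hc.2.const_smul a))
  have i : ∫ x : ℝ, ((x : ℂ) * (a • f) x) * conj ((x : ℂ) * g x) =
      ∫ x : ℝ, a * (((x : ℂ) * f x) * conj ((x : ℂ) * g x)) := by
    apply integral_congr_ae
    filter_upwards [Lp.coeFn_smul a f] with x hx
    rw [hx, Pi.smul_apply, smul_eq_mul]; ring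
  rw [form, w, c, i, integral_const_mul, inner_smul_right, inner_smul_right, form,
    Pi.smul_apply, Pi.smul_apply, smul_eq_mul, smul_eq_mul]
  ring

/-- The graph of the operator associated with the form: the pairs `(f, h)` with `f` in the form
domain, `h ∈ L²(ℝ)`, and `t(f, g) = ⟨h, g⟩` for all `g` in the form domain. -/
def operatorGraph (z : ℂ) (b : ℝ) : Submodule ℂ (L2 × L2) where
  carrier := {p | p.1 ∈ formDomain ∧ ∀ g ∈ formDomain, form z b p.1 g = inner ℂ g p.2}
  zero_mem' := by
    refine ⟨formDomain.zero_mem, fun g _ => ?_⟩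
    have := form_smul z b 0 (f := 0) (g := g) formDomain.zero_mem
    simpa using this
  add_mem' := by
    rintro p q ⟨hp, hp'⟩ ⟨hq, hq'⟩
    refine ⟨formDomain.add_mem hp hq, fun g hg => ?_⟩
    rw [Prod.fst_add, Prod.snd_add, form_add z b hp hq hg, hp' g hg, hq' g hg, inner_add_right]
  smul_mem' := by
    rintro a p ⟨hp, hp'⟩
    refine ⟨formDomain.smul_mem a hp, fun g hg => ?_⟩
    rw [Prod.smul_fst, Prod.smul_snd, form_smul z b a hp, hp' g hg, inner_smul_right]

/-- The operator `-y'' + (x²/4 - 1/2) y + z (δ(x - b) - δ(x + b)) y` on `L²(ℝ)`, defined by the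
quadratic form method. -/
def pcOperator (z : ℂ) (b : ℝ) : L2 →ₗ.[ℂ] L2 := (operatorGraph z b).toLinearPMap

/-- Test functions lie in the form domain. -/
theorem exists_mem_formDomain {φ : ℝ → ℝ} (hφ : ContDiff ℝ ∞ φ) (hc : HasCompactSupport φ) :
    ∃ f ∈ formDomain, f =ᵐ[volume] fun x => (φ x : ℂ) := by
  have mem : ∀ ψ : ℝ → ℝ, Continuous ψ → HasCompactSupport ψ →
      MemLp (fun x => (ψ x : ℂ)) 2 volume := fun ψ hψ hψc =>
    (Complex.continuous_ofReal.comp hψ).memLp_of_hasCompactSupport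
      (hψc.comp_left Complex.ofReal_zero)
  have hd := continuous_deriv_of_smooth hφ
  have m0 := mem φ hφ.continuous hc
  have m1 := mem (deriv φ) hd hc.deriv
  refine ⟨m0.toLp _, ⟨⟨m1.toLp _, ?_⟩, ?_⟩, m0.coeFn_toLp⟩
  · intro χ hχ hχc
    have e1 : ∫ x, deriv χ x • (m0.toLp _ : L2) x = ((∫ x, φ x * deriv χ x : ℝ) : ℂ) := by
      rw [← integral_complex_ofReal]
      apply integral_congr_ae
      filter_upwards [m0.coeFn_toLp] with x hx
      rw [hx, Complex.real_smul]; push_cast; ring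
    have e2 : ∫ x, χ x • (m1.toLp _ : L2) x = ((∫ x, deriv φ x * χ x : ℝ) : ℂ) := by
      rw [← integral_complex_ofReal]
      apply integral_congr_ae
      filter_upwards [m1.coeFn_toLp] with x hx
      rw [hx, Complex.real_smul]; push_cast; ring
    have hdχ := continuous_deriv_of_smooth hχ
    rw [e1, e2, ← Complex.ofReal_neg]
    congr 1
    refine integral_mul_deriv_eq_deriv_mul_of_integrable
      (fun x _ => (hφ.differentiable (by simp) x).hasDerivAt)
      (fun x _ => (hχ.differentiable (by simp) x).hasDerivAt) ?_ ?_ ?_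
    · exact (hφ.continuous.mul hdχ).integrable_of_hasCompactSupport hc.mul_right
    · exact (hd.mul hχ.continuous).integrable_of_hasCompactSupport hc.deriv.mul_right
    · exact (hφ.continuous.mul hχ.continuous).integrable_of_hasCompactSupport hc.mul_right
  · refine (mem (fun x => x * φ x) (continuous_id.mul hφ.continuous) hc.mul_left).ae_eq ?_
    filter_upwards [m0.coeFn_toLp] with x hx
    rw [hx]; push_cast; ring

/-- The graph of `pcOperator z b` is `operatorGraph z b`, because the form domain is dense. -/
theorem pcOperator_graph (z : ℂ) (b : ℝ) : (pcOperator z b).graph = operatorGraph z b := by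
  refine Submodule.toLinearPMap_graph_eq _ ?_
  rintro ⟨f, h⟩ ⟨hf, hh⟩ (hf0 : f = 0)
  subst hf0
  have hz : ∀ g ∈ formDomain, inner ℂ g h = 0 := fun g hg => by
    have h1 := form_smul z b 0 (f := 0) (g := g) formDomain.zero_mem
    rw [zero_mul, smul_zero] at h1
    rw [← hh g hg, h1]
  change h = 0
  apply Lp.ext
  refine Filter.EventuallyEq.trans ?_ (Lp.coeFn_zero ℂ 2 (volume : Measure ℝ)).symm
  refine ae_eq_zero_of_integral_contDiff_smul_eq_zero (L2.locallyIntegrable h) ?_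
  intro φ hφ hc
  obtain ⟨g, hg, hgφ⟩ := exists_mem_formDomain hφ hc
  rw [← hz g hg, L2.inner_def]
  apply integral_congr_ae
  filter_upwards [hgφ] with x hx
  rw [hx, RCLike.inner_apply, Complex.conj_ofReal, Complex.real_smul, mul_comm]

end

end OddPair

/-!
Adding to `x² / 4 - 1 / 2 - ν` a compactly supported multiplication operator `K` that offsets its
negative part makes the form coercive on the Hilbert space `𝒟`, whatever `z` is: the point values
are controlled by `|f(±b)|² ≤ ‖f‖ ‖f'‖`. Hence `L - ν + K` is boundedly invertible, `L` is closed,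
and solving `(L - ν) g = h` reduces to a right-hand side of compact support.

Away from `±b` such a `g` solves the parabolic cylinder equation and is determined by a solution
`u` of the inhomogeneous equation together with the jumps `z f(b)`, `-z f(-b)` of `g'`. To the
right of `b` and of the source the Wronskian of `g` and `D_ν` is constant. As `D_ν` decays
superpolynomially, a square integrable `g` forces this constant to be zero, and conversely zero
makes `g` a multiple of `D_ν`. Reflection `x ↦ -x` with `z ↦ -z` gives the condition at `-∞`.

The two conditions are affine in the coefficients of `u` along `y_even`, `y_odd`. Writing
`D_ν = A y_even - B y_odd`, so that `A B = √π / (√2 Γ(-ν))`, their determinant is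
`-2 (A B - z² D_ν(b)² y_even(b) y_odd(b))`. If it is zero, a null vector is an eigenfunction; if
not, `L - ν` is bijective, and its inverse is bounded by the closed graph theorem.
-/

namespace OddPair

noncomputable section

/-! ### The power series -/

/-- The product `μ (μ + 2) ⋯ (μ + 2 (k - 1))`, a Pochhammer symbol with step `2`. -/
def stepProd (μ : ℂ) (k : ℕ) : ℂ := ∏ j ∈ Finset.range k, (μ + 2 * (j : ℂ))

theorem stepProd_succ (μ : ℂ) (k : ℕ) : stepProd μ (k + 1) = stepProd μ k * (μ + 2 * k) :=
  Finset.prod_range_succ _ _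

theorem stepProd_succ_left (μ : ℂ) (k : ℕ) : stepProd μ (k + 1) = μ * stepProd (μ + 2) k := by
  rw [stepProd, Finset.prod_range_succ', mul_comm, stepProd]
  congr 1
  · simp
  · exact Finset.prod_congr rfl fun j _ => by push_cast; ring

theorem norm_stepProd_le (μ : ℂ) (k : ℕ) :
    ‖stepProd μ k‖ ≤ (‖μ‖ + 2) ^ k * (k.factorial : ℝ) := by
  induction k with
  | zero => simp [stepProd]
  | succ k ih =>
    have h : ‖μ + 2 * (k : ℂ)‖ ≤ (‖μ‖ + 2) * ((k + 1 : ℕ) : ℝ) := by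
      calc ‖μ + 2 * (k : ℂ)‖ ≤ ‖μ‖ + 2 * k := by simpa using norm_add_le μ (2 * (k : ℂ))
        _ ≤ (‖μ‖ + 2) * ((k + 1 : ℕ) : ℝ) := by
          push_cast
          nlinarith [norm_nonneg μ, Nat.cast_nonneg (α := ℝ) k]
    calc ‖stepProd μ (k + 1)‖ = ‖stepProd μ k‖ * ‖μ + 2 * (k : ℂ)‖ := by
          rw [stepProd_succ, norm_mul]
      _ ≤ ((‖μ‖ + 2) ^ k * (k.factorial : ℝ)) * ((‖μ‖ + 2) * ((k + 1 : ℕ) : ℝ)) := by gcongr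
      _ = (‖μ‖ + 2) ^ (k + 1) * ((k + 1).factorial : ℝ) := by
          rw [Nat.factorial_succ]; push_cast; ring

/-- The terms of the series in `yEven` (for `ε = 0`) and `yOdd` (for `ε = 1`). Larger `ε` make the
family closed under integration in `x`, see `hasDerivAt_pcTerm`. -/
def pcTerm (ε : ℕ) (ν x : ℂ) (k : ℕ) : ℂ :=
  stepProd (-ν + ε) k * x ^ (2 * k + ε) / ((2 * k + ε).factorial : ℂ)

/-- The sum of the series with terms `pcTerm ε ν x`. -/
def pcSeries (ε : ℕ) (ν x : ℂ) : ℂ := ∑' k, pcTerm ε ν x k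

theorem yEven_eq (ν x : ℂ) : yEven ν x = Complex.exp (-x ^ 2 / 4) * pcSeries 0 ν x := by
  simp [yEven, pcSeries, pcTerm, stepProd]

theorem yOdd_eq (ν x : ℂ) : yOdd ν x = Complex.exp (-x ^ 2 / 4) * pcSeries 1 ν x := by
  simp [yOdd, pcSeries, pcTerm, stepProd]

theorem norm_pcTerm_le (ε : ℕ) (ν : ℂ) {x : ℂ} {r : ℝ} (hx : ‖x‖ ≤ r) (k : ℕ) :
    ‖pcTerm ε ν x k‖ ≤ r ^ ε * (((‖-ν + ε‖ + 2) * r ^ 2) ^ k / k.factorial) := by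
  have hr : 0 ≤ r := (norm_nonneg x).trans hx
  have hfac : k.factorial * k.factorial ≤ (2 * k + ε).factorial := by
    calc k.factorial * k.factorial ≤ (k + k).factorial :=
          Nat.le_of_dvd (Nat.factorial_pos _) (Nat.factorial_mul_factorial_dvd_factorial_add k k)
      _ ≤ (2 * k + ε).factorial := Nat.factorial_le (by omega)
  have hfac' : (k.factorial : ℝ) * k.factorial ≤ ((2 * k + ε).factorial : ℝ) := by
    exact_mod_cast hfac
  calc ‖pcTerm ε ν x k‖ = ‖stepProd (-ν + ε) k‖ * ‖x‖ ^ (2 * k + ε) / (2 * k + ε).factorial := by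
        simp [pcTerm]
    _ ≤ (‖-ν + ε‖ + 2) ^ k * k.factorial * r ^ (2 * k + ε) / (k.factorial * k.factorial) := by
        gcongr
        exact norm_stepProd_le _ k
    _ = r ^ ε * (((‖-ν + ε‖ + 2) * r ^ 2) ^ k / k.factorial) := by
        rw [pow_add, pow_mul, mul_pow]
        field_simp

theorem summable_pcTerm (ε : ℕ) (ν x : ℂ) : Summable (pcTerm ε ν x) :=
  .of_norm_bounded ((Real.summable_pow_div_factorial _).mul_left _) (norm_pcTerm_le ε ν le_rfl)

theorem hasDerivAt_pcTerm (ε : ℕ) (ν x : ℂ) (k : ℕ) :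
    HasDerivAt (fun w => pcTerm (ε + 1) ν w k) (pcTerm ε (ν - 1) x k) x := by
  refine (((hasDerivAt_pow (2 * k + (ε + 1)) x).const_mul _).div_const _).congr_deriv ?_
  have h1 : ((2 * k + ε + 1 : ℕ) : ℂ) ≠ 0 := Nat.cast_ne_zero.2 (Nat.succ_ne_zero _)
  have h2 : ((2 * k + ε).factorial : ℂ) ≠ 0 := by exact_mod_cast Nat.factorial_ne_zero _
  rw [pcTerm, ← add_assoc, Nat.add_sub_cancel, Nat.factorial_succ, Nat.cast_mul, Nat.cast_succ ε,
    show -(ν - 1) + (ε : ℂ) = -ν + (ε + 1) by ring]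
  field_simp

theorem hasDerivAt_pcSeries_succ (ε : ℕ) (ν x : ℂ) :
    HasDerivAt (pcSeries (ε + 1) ν) (pcSeries ε (ν - 1) x) x :=
  hasDerivAt_tsum_of_isPreconnected (t := Metric.ball 0 (‖x‖ + 1))
    ((Real.summable_pow_div_factorial _).mul_left _) Metric.isOpen_ball
    (convex_ball _ _).isPreconnected (fun k w _ => hasDerivAt_pcTerm ε ν w k)
    (fun k _ hw => norm_pcTerm_le ε (ν - 1) (mem_ball_zero_iff.1 hw).le k)
    (Metric.mem_ball_self (by positivity)) (summable_pcTerm (ε + 1) ν 0) (by simp)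

theorem pcSeries_zero_eq (ν x : ℂ) : pcSeries 0 ν x = 1 - ν * pcSeries 2 ν x := by
  have hterm : ∀ k, pcTerm 0 ν x (k + 1) = -ν * pcTerm 2 ν x k := fun k => by
    simp only [pcTerm, stepProd_succ_left, Nat.cast_zero, add_zero, mul_add_one, Nat.cast_ofNat]
    ring
  rw [pcSeries, (summable_pcTerm 0 ν x).tsum_eq_zero_add, tsum_congr hterm, tsum_mul_left, pcSeries]
  simp [pcTerm, stepProd, sub_eq_add_neg]

theorem hasDerivAt_pcSeries_zero (ν x : ℂ) :
    HasDerivAt (pcSeries 0 ν) (-ν * pcSeries 1 (ν - 1) x) x := by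
  rw [funext (pcSeries_zero_eq ν)]
  exact (((hasDerivAt_pcSeries_succ 1 ν x).const_mul ν).const_sub 1).congr_deriv (neg_mul _ _).symm

theorem mul_pcTerm (ε : ℕ) (ν x : ℂ) (k : ℕ) : x * pcTerm ε ν x k =
    (ε - ν) * pcTerm (ε + 1) (ν - 1) x k + (ν + 1) * pcTerm (ε + 1) (ν + 1) x k := by
  have hshift : (-ν + ε) * stepProd (-ν + ε + 2) k = stepProd (-ν + ε) k * (-ν + ε + 2 * k) := by
    rw [← stepProd_succ, stepProd_succ_left]
  have h1 : (2 * (k : ℂ) + ε + 1) ≠ 0 := by exact_mod_cast Nat.succ_ne_zero (2 * k + ε)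
  have h2 : ((2 * k + ε).factorial : ℂ) ≠ 0 := by exact_mod_cast Nat.factorial_ne_zero _
  simp only [pcTerm, ← add_assoc, Nat.factorial_succ, Nat.cast_succ]
  rw [show -(ν - 1) + (ε : ℂ) + 1 = -ν + ε + 2 by ring,
    show -(ν + 1) + (ε : ℂ) + 1 = -ν + ε by ring]
  push_cast
  field_simp
  linear_combination -x ^ (2 * k + ε + 1) * hshift

theorem mul_pcSeries (ε : ℕ) (ν x : ℂ) : x * pcSeries ε ν x =
    (ε - ν) * pcSeries (ε + 1) (ν - 1) x + (ν + 1) * pcSeries (ε + 1) (ν + 1) x := by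
  rw [pcSeries, ← tsum_mul_left, tsum_congr (mul_pcTerm ε ν x),
    ((summable_pcTerm _ _ x).mul_left _).tsum_add ((summable_pcTerm _ _ x).mul_left _),
    tsum_mul_left, tsum_mul_left, pcSeries, pcSeries]

/-! ### Ladder relations and the differential equation -/

theorem hasDerivAt_exp_neg_sq (x : ℂ) : HasDerivAt (fun w : ℂ => Complex.exp (-w ^ 2 / 4))
    (-(x / 2) * Complex.exp (-x ^ 2 / 4)) x := by
  have h : HasDerivAt (fun w : ℂ => -w ^ 2 / 4) (-(x / 2)) x :=
    ((hasDerivAt_pow 2 x).neg.div_const 4).congr_deriv (by norm_num; ring)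
  exact h.cexp.congr_deriv (mul_comm _ _)

/-- The derivative of `yEven ν`. -/
def yEvenDeriv (ν x : ℂ) : ℂ := -(x / 2) * yEven ν x - ν * yOdd (ν - 1) x

/-- The derivative of `yOdd ν`. -/
def yOddDeriv (ν x : ℂ) : ℂ := -(x / 2) * yOdd ν x + yEven (ν - 1) x

theorem hasDerivAt_yEven (ν x : ℂ) : HasDerivAt (yEven ν) (yEvenDeriv ν x) x := by
  rw [funext (yEven_eq ν)]
  refine ((hasDerivAt_exp_neg_sq x).mul (hasDerivAt_pcSeries_zero ν x)).congr_deriv ?_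
  rw [yEvenDeriv, yEven_eq, yOdd_eq]
  ring

theorem hasDerivAt_yOdd (ν x : ℂ) : HasDerivAt (yOdd ν) (yOddDeriv ν x) x := by
  rw [funext (yOdd_eq ν)]
  refine ((hasDerivAt_exp_neg_sq x).mul (hasDerivAt_pcSeries_succ 0 ν x)).congr_deriv ?_
  rw [yOddDeriv, yEven_eq, yOdd_eq]
  ring

theorem mul_yEven (ν x : ℂ) :
    x * yEven ν x = (ν + 1) * yOdd (ν + 1) x - ν * yOdd (ν - 1) x := by
  have h := mul_pcSeries 0 ν x
  rw [Nat.cast_zero, zero_sub, zero_add] at h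
  rw [yEven_eq, yOdd_eq, yOdd_eq]
  linear_combination Complex.exp (-x ^ 2 / 4) * h

theorem mul_yOdd (ν x : ℂ) : x * yOdd ν x = yEven (ν - 1) x - yEven (ν + 1) x := by
  have h := mul_pcSeries 1 ν x
  rw [Nat.cast_one, one_add_one_eq_two] at h
  rw [yEven_eq, yEven_eq, yOdd_eq, pcSeries_zero_eq, pcSeries_zero_eq]
  linear_combination Complex.exp (-x ^ 2 / 4) * h

theorem hasDerivAt_yEvenDeriv (ν x : ℂ) :
    HasDerivAt (yEvenDeriv ν) ((x ^ 2 / 4 - 1 / 2 - ν) * yEven ν x) x := by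
  refine ((((hasDerivAt_id x).div_const 2).neg.mul (hasDerivAt_yEven ν x)).sub
    ((hasDerivAt_yOdd (ν - 1) x).const_mul ν)).congr_deriv ?_
  have h := mul_yOdd (ν - 1) x
  rw [sub_add_cancel] at h
  simp only [Pi.neg_apply, id, yEvenDeriv, yOddDeriv]
  linear_combination ν * h

theorem hasDerivAt_yOddDeriv (ν x : ℂ) :
    HasDerivAt (yOddDeriv ν) ((x ^ 2 / 4 - 1 / 2 - ν) * yOdd ν x) x := by
  refine ((((hasDerivAt_id x).div_const 2).neg.mul (hasDerivAt_yOdd ν x)).add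
    (hasDerivAt_yEven (ν - 1) x)).congr_deriv ?_
  have h := mul_yEven (ν - 1) x
  rw [sub_add_cancel] at h
  simp only [Pi.neg_apply, id, yEvenDeriv, yOddDeriv]
  linear_combination -h

theorem yEven_zero (ν : ℂ) : yEven ν 0 = 1 := by
  rw [yEven_eq, pcSeries_zero_eq]
  simp [pcSeries, pcTerm]

theorem yOdd_zero (ν : ℂ) : yOdd ν 0 = 0 := by
  simp [yOdd_eq, pcSeries, pcTerm]

theorem yEven_neg (ν x : ℂ) : yEven ν (-x) = yEven ν x := by
  simp only [yEven, pow_mul, neg_sq]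

theorem yOdd_neg (ν x : ℂ) : yOdd ν (-x) = -yOdd ν x := by
  simp only [yOdd, pow_succ _ (2 * _), pow_mul, neg_sq, mul_neg, neg_div, tsum_neg]

theorem yEvenDeriv_neg (ν x : ℂ) : yEvenDeriv ν (-x) = -yEvenDeriv ν x := by
  rw [yEvenDeriv, yEvenDeriv, yEven_neg, yOdd_neg]
  ring

theorem yOddDeriv_neg (ν x : ℂ) : yOddDeriv ν (-x) = yOddDeriv ν x := by
  rw [yOddDeriv, yOddDeriv, yEven_neg, yOdd_neg]
  ring

theorem wronskian_yEven_yOdd (ν x : ℂ) :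
    yEven ν x * yOddDeriv ν x - yEvenDeriv ν x * yOdd ν x = 1 := by
  have hd : ∀ w, HasDerivAt (fun w => yEven ν w * yOddDeriv ν w - yEvenDeriv ν w * yOdd ν w) 0 w :=
    fun w => (((hasDerivAt_yEven ν w).mul (hasDerivAt_yOddDeriv ν w)).sub
      ((hasDerivAt_yEvenDeriv ν w).mul (hasDerivAt_yOdd ν w))).congr_deriv (by ring)
  rw [is_const_of_deriv_eq_zero (fun w => (hd w).differentiableAt) (fun w => (hd w).deriv) x 0]
  simp [yEvenDeriv, yOddDeriv, yEven_zero, yOdd_zero]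

/-! ### The parabolic cylinder function -/

/-- The coefficient of `yEven` in `parabolicD`, that is `D_ν(0)`. -/
def evenCoeff (ν : ℂ) : ℂ := (2 : ℂ) ^ (ν / 2) * (√Real.pi : ℂ) * recipGamma (-ν / 2 + 1 / 2)

/-- The negative of the coefficient of `yOdd` in `parabolicD`, that is `-D_ν'(0)`. -/
def oddCoeff (ν : ℂ) : ℂ := (2 : ℂ) ^ ((ν + 1) / 2) * (√Real.pi : ℂ) * recipGamma (-ν / 2)

theorem parabolicD_eq (ν x : ℂ) :
    parabolicD ν x = evenCoeff ν * yEven ν x - oddCoeff ν * yOdd ν x := rfl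

theorem two_cpow_ne_zero (s : ℂ) : (2 : ℂ) ^ s ≠ 0 := by
  simp [Complex.cpow_eq_zero_iff]

theorem sqrt_pi_ne_zero : (√Real.pi : ℂ) ≠ 0 := by
  exact_mod_cast (Real.sqrt_pos.2 Real.pi_pos).ne'

theorem evenCoeff_add_one (ν : ℂ) : evenCoeff (ν + 1) = oddCoeff ν := by
  rw [evenCoeff, oddCoeff, show -(ν + 1) / 2 + 1 / 2 = -ν / 2 by ring]

theorem oddCoeff_add_one (ν : ℂ) : oddCoeff (ν + 1) = -(ν + 1) * evenCoeff ν := by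
  rw [evenCoeff, oddCoeff, recipGamma, Complex.one_div_Gamma_eq_self_mul_one_div_Gamma_add_one,
    show -(ν + 1) / 2 + 1 = -ν / 2 + 1 / 2 by ring, recipGamma,
    show (ν + 1 + 1) / 2 = ν / 2 + 1 by ring, Complex.cpow_add _ _ two_ne_zero, Complex.cpow_one]
  ring

theorem evenCoeff_eq (ν : ℂ) : evenCoeff ν = oddCoeff (ν - 1) := by
  rw [← evenCoeff_add_one, sub_add_cancel]

theorem oddCoeff_eq (ν : ℂ) : oddCoeff ν = -ν * evenCoeff (ν - 1) := by
  simpa using oddCoeff_add_one (ν - 1)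

theorem oddCoeff_eq_zero_iff (ν : ℂ) : oddCoeff ν = 0 ↔ ∃ m : ℕ, ν = 2 * m := by
  simp only [oddCoeff, recipGamma, mul_eq_zero, two_cpow_ne_zero, sqrt_pi_ne_zero, or_self,
    false_or, inv_eq_zero, Complex.Gamma_eq_zero_iff]
  exact exists_congr fun m => ⟨fun h => by linear_combination -2 * h, fun h => by rw [h]; ring⟩

theorem evenCoeff_ne_zero_or_oddCoeff_ne_zero (ν : ℂ) : evenCoeff ν ≠ 0 ∨ oddCoeff ν ≠ 0 := by
  by_contra! h
  obtain ⟨m, hm⟩ := (oddCoeff_eq_zero_iff (ν - 1)).1 (evenCoeff_eq ν ▸ h.1)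
  obtain ⟨n, hn⟩ := (oddCoeff_eq_zero_iff ν).1 h.2
  rw [sub_eq_iff_eq_add, hn] at hm
  have : 2 * n = 2 * m + 1 := by exact_mod_cast hm
  omega

theorem evenCoeff_mul_oddCoeff (ν : ℂ) :
    evenCoeff ν * oddCoeff ν = (√Real.pi : ℂ) / (√2 : ℂ) * recipGamma (-ν) := by
  have hsqrt : (√2 : ℂ) = (2 : ℂ) ^ (1 / 2 : ℂ) := by
    rw [Real.sqrt_eq_rpow, Complex.ofReal_cpow zero_le_two]
    norm_num
  have hpow : (2 : ℂ) ^ (ν / 2) * (2 : ℂ) ^ ((ν + 1) / 2) * (2 : ℂ) ^ (1 / 2 : ℂ) =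
      (2 : ℂ) ^ (1 - -ν) := by
    rw [← Complex.cpow_add _ _ two_ne_zero, ← Complex.cpow_add _ _ two_ne_zero]
    congr 1
    ring
  have hduplication : Complex.Gamma (-ν / 2) * Complex.Gamma (-ν / 2 + 1 / 2) =
      Complex.Gamma (-ν) * (2 : ℂ) ^ (1 - -ν) * (√Real.pi : ℂ) := by
    simpa only [mul_div_cancel₀ _ (two_ne_zero' ℂ)] using
      Complex.Gamma_mul_Gamma_add_half (-ν / 2)
  have hπ := sqrt_pi_ne_zero
  have h1 := two_cpow_ne_zero (1 / 2)
  have h2 := two_cpow_ne_zero (ν / 2)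
  have h3 := two_cpow_ne_zero ((ν + 1) / 2)
  calc evenCoeff ν * oddCoeff ν
      = (2 : ℂ) ^ (ν / 2) * (2 : ℂ) ^ ((ν + 1) / 2) * ((√Real.pi : ℂ) * (√Real.pi : ℂ)) *
        (Complex.Gamma (-ν / 2) * Complex.Gamma (-ν / 2 + 1 / 2))⁻¹ := by
        rw [evenCoeff, oddCoeff, recipGamma, recipGamma, mul_inv]
        ring
    _ = (√Real.pi : ℂ) / (√2 : ℂ) * recipGamma (-ν) := by
        rw [hduplication, hsqrt, ← hpow, recipGamma, mul_inv, mul_inv]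
        field_simp

/-- The derivative of `parabolicD ν`. -/
def parabolicDDeriv (ν x : ℂ) : ℂ := evenCoeff ν * yEvenDeriv ν x - oddCoeff ν * yOddDeriv ν x

theorem parabolicDDeriv_eq (ν x : ℂ) :
    parabolicDDeriv ν x = -(x / 2) * parabolicD ν x + ν * parabolicD (ν - 1) x := by
  rw [parabolicDDeriv, parabolicD_eq, parabolicD_eq, yEvenDeriv, yOddDeriv, ← evenCoeff_eq]
  linear_combination -yEven (ν - 1) x * oddCoeff_eq ν

theorem parabolicD_add_one (ν x : ℂ) :
    parabolicD (ν + 1) x = x * parabolicD ν x - ν * parabolicD (ν - 1) x := by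
  rw [parabolicD_eq, parabolicD_eq, parabolicD_eq, evenCoeff_add_one, oddCoeff_add_one,
    ← evenCoeff_eq]
  linear_combination oddCoeff ν * mul_yOdd ν x - evenCoeff ν * mul_yEven ν x +
    yEven (ν - 1) x * oddCoeff_eq ν

/-! ### The integral representation -/

/-- The density `t^{s-1} e^{-t²/2}`, whose Laplace transform on `(0, ∞)` represents `D_{-s}`. -/
def gaussWeight (s : ℂ) (t : ℝ) : ℂ := (t : ℂ) ^ (s - 1) * (Real.exp (-(t ^ 2 / 2)) : ℂ)

/-- The closed form of the moment `∫ t^{s-1} e^{-t²/2} dt` over `(0, ∞)`. -/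
def gaussMoment (s : ℂ) : ℂ := (2 : ℂ) ^ (s / 2 - 1) * Complex.Gamma (s / 2)

theorem continuousOn_gaussWeight (s : ℂ) : ContinuousOn (gaussWeight s) (Set.Ioi 0) := fun t ht =>
  ((Complex.continuousAt_ofReal_cpow_const t (s - 1) (Or.inr (ne_of_gt ht))).mul
    (by fun_prop)).continuousWithinAt

theorem norm_gaussWeight (s : ℂ) {t : ℝ} (ht : 0 < t) :
    ‖gaussWeight s t‖ = t ^ (s.re - 1) * Real.exp (-(t ^ 2 / 2)) := by
  rw [gaussWeight, norm_mul, Complex.norm_cpow_eq_rpow_re_of_pos ht, Complex.norm_real,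
    Real.norm_of_nonneg (Real.exp_pos _).le, Complex.sub_re, Complex.one_re]

theorem gaussWeight_mul_pow (s : ℂ) (n : ℕ) {t : ℝ} (ht : t ≠ 0) :
    gaussWeight s t * (t : ℂ) ^ n = gaussWeight (s + n) t := by
  rw [gaussWeight, gaussWeight, add_sub_right_comm, Complex.cpow_add _ _ (by exact_mod_cast ht),
    Complex.cpow_natCast]
  ring

theorem integrableOn_gaussWeight_mul_exp {s : ℂ} (hs : 0 < s.re) (a : ℝ) :
    IntegrableOn (fun t => gaussWeight s t * Real.exp (a * t)) (Set.Ioi 0) := by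
  have hbound : IntegrableOn
      (fun t : ℝ => Real.exp (a ^ 2) * (t ^ (s.re - 1) * Real.exp (-(1 / 4) * t ^ 2)))
      (Set.Ioi 0) :=
    (integrableOn_rpow_mul_exp_neg_mul_sq (by norm_num) (by linarith)).const_mul _
  refine Integrable.mono' hbound (((continuousOn_gaussWeight s).mul
    (by fun_prop)).aestronglyMeasurable measurableSet_Ioi) ?_
  filter_upwards [ae_restrict_mem measurableSet_Ioi] with t ht
  have ht' : (0 : ℝ) < t := ht
  rw [norm_mul, norm_gaussWeight s ht', Complex.norm_real, Real.norm_of_nonneg (Real.exp_pos _).le,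
    mul_assoc, ← Real.exp_add, mul_left_comm, ← Real.exp_add]
  refine mul_le_mul_of_nonneg_left (Real.exp_le_exp.2 ?_) (by positivity)
  nlinarith [sq_nonneg (t / 2 - a)]

theorem integral_gaussWeight {s : ℂ} (hs : 0 < s.re) :
    ∫ t in Set.Ioi (0 : ℝ), gaussWeight s t = gaussMoment s := by
  have hs2 : 0 < (s / (2 : ℝ)).re := by
    rw [Complex.div_ofReal_re]
    positivity
  have hsubst := mellin_comp_rpow (fun t : ℝ => Complex.exp (-(((1 / 2 : ℝ) : ℂ) * t))) s 2
  have hgamma := Complex.integral_cpow_mul_exp_neg_mul_Ioi hs2 (one_half_pos (α := ℝ))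
  simp only [mellin, smul_eq_mul] at hsubst
  rw [hgamma, abs_of_pos two_pos, Complex.real_smul] at hsubst
  calc ∫ t in Set.Ioi (0 : ℝ), gaussWeight s t
      = ∫ t in Set.Ioi (0 : ℝ), (t : ℂ) ^ (s - 1) *
          Complex.exp (-(((1 / 2 : ℝ) : ℂ) * ((t ^ (2 : ℝ) : ℝ) : ℂ))) := by
        congr 1
        ext t
        rw [gaussWeight, Real.rpow_two, Complex.ofReal_exp]
        push_cast
        ring_nf
    _ = gaussMoment s := by
        rw [hsubst, gaussMoment, Complex.cpow_sub _ _ two_ne_zero, Complex.cpow_one]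
        push_cast
        rw [one_div_one_div]
        ring

theorem gaussMoment_add_two {s : ℂ} (hs : s ≠ 0) : gaussMoment (s + 2) = s * gaussMoment s := by
  rw [gaussMoment, gaussMoment, show (s + 2) / 2 = s / 2 + 1 by ring,
    Complex.Gamma_add_one _ (div_ne_zero hs two_ne_zero), add_sub_cancel_right,
    Complex.cpow_sub _ _ two_ne_zero, Complex.cpow_one]
  ring

theorem gaussMoment_add_two_mul {s : ℂ} (hs : 0 < s.re) (k : ℕ) :
    gaussMoment (s + 2 * k) = stepProd s k * gaussMoment s := by
  induction k with
  | zero => simp [stepProd]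
  | succ k ih =>
    have hre : 0 < (s + 2 * k).re := by
      simp only [Complex.add_re, Complex.mul_re, Complex.re_ofNat, Complex.natCast_re,
        Complex.im_ofNat, Complex.natCast_im, mul_zero, sub_zero]
      positivity
    rw [stepProd_succ, show s + 2 * ((k + 1 : ℕ) : ℂ) = s + 2 * k + 2 by push_cast; ring,
      gaussMoment_add_two (Complex.ne_zero_of_re_pos hre), ih]
    ring

theorem hasSum_integral_gaussWeight_mul_exp {s : ℂ} (hs : 0 < s.re) (x : ℝ) :
    HasSum (fun n : ℕ => (-(x : ℂ)) ^ n / (n.factorial : ℂ) * gaussMoment (s + n))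
      (∫ t in Set.Ioi (0 : ℝ), gaussWeight s t * Complex.exp (-(x : ℂ) * t)) := by
  let term : ℕ → ℝ → ℂ := fun n t => gaussWeight s t * ((-(x : ℂ) * t) ^ n / (n.factorial : ℂ))
  let bound : ℕ → ℝ → ℝ := fun n t => ‖gaussWeight s t‖ * ((|x| * t) ^ n / (n.factorial : ℝ))
  have hbound : ∀ t, HasSum (bound · t) (‖gaussWeight s t‖ * Real.exp (|x| * t)) := fun t => by
    rw [Real.exp_eq_exp_ℝ]
    exact (NormedSpace.expSeries_div_hasSum_exp (|x| * t)).mul_left _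
  have hterm : ∀ n, ∫ t in Set.Ioi (0 : ℝ), term n t =
      (-(x : ℂ)) ^ n / (n.factorial : ℂ) * gaussMoment (s + n) := fun n => by
    have hsn : 0 < (s + n).re := by
      rw [Complex.add_re, Complex.natCast_re]
      positivity
    rw [← integral_gaussWeight hsn, ← integral_const_mul]
    refine setIntegral_congr_fun measurableSet_Ioi fun t ht => ?_
    simp only [term, ← gaussWeight_mul_pow s n (ne_of_gt ht), mul_pow]
    ring
  simp_rw [← hterm]
  refine hasSum_integral_of_dominated_convergence bound (fun n => ?_) (fun n => ?_)
    (.of_forall fun t => (hbound t).summable) ?_ (.of_forall fun t => ?_)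
  · exact ((continuousOn_gaussWeight s).mul (by fun_prop)).aestronglyMeasurable measurableSet_Ioi
  · filter_upwards [ae_restrict_mem measurableSet_Ioi] with t ht
    simp [term, bound, abs_of_pos (Set.mem_Ioi.1 ht)]
  · simp_rw [fun t => (hbound t).tsum_eq]
    refine (integrableOn_gaussWeight_mul_exp hs |x|).norm.congr (.of_forall fun t => ?_)
    beta_reduce
    rw [norm_mul, Complex.norm_real, Real.norm_of_nonneg (Real.exp_pos _).le]
  · rw [Complex.exp_eq_exp_ℂ]
    exact (NormedSpace.expSeries_div_hasSum_exp (-(x : ℂ) * t)).mul_left _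

theorem integral_gaussWeight_mul_exp {s : ℂ} (hs : 0 < s.re) (x : ℝ) :
    ∫ t in Set.Ioi (0 : ℝ), gaussWeight s t * Complex.exp (-(x : ℂ) * t) =
      gaussMoment s * pcSeries 0 (-s) x - gaussMoment (s + 1) * pcSeries 1 (-s) x := by
  have hs1 : 0 < (s + 1).re := by
    rw [Complex.add_re, Complex.one_re]
    positivity
  refine (hasSum_integral_gaussWeight_mul_exp hs x).unique ?_
  rw [sub_eq_add_neg, ← neg_mul]
  refine HasSum.even_add_odd
    (((summable_pcTerm 0 (-s) x).hasSum.mul_left (gaussMoment s)).congr_fun fun k => ?_)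
    (((summable_pcTerm 1 (-s) x).hasSum.mul_left (-gaussMoment (s + 1))).congr_fun fun k => ?_)
  · rw [Nat.cast_mul, Nat.cast_two, gaussMoment_add_two_mul hs, pcTerm, neg_neg, Nat.cast_zero,
      add_zero, add_zero, Even.neg_pow (even_two_mul k)]
    ring
  · rw [show s + ((2 * k + 1 : ℕ) : ℂ) = s + 1 + 2 * k by push_cast; ring,
      gaussMoment_add_two_mul hs1, pcTerm, neg_neg, Nat.cast_one, Odd.neg_pow ⟨k, rfl⟩]
    ring

theorem evenCoeff_neg_mul_Gamma {s : ℂ} (hs : 0 < s.re) :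
    evenCoeff (-s) * Complex.Gamma s = gaussMoment s := by
  have hdup := Complex.Gamma_mul_Gamma_add_half (s / 2)
  have hΓ : Complex.Gamma (s / 2 + 1 / 2) ≠ 0 :=
    Complex.Gamma_ne_zero_of_re_pos (by simp; linarith)
  have hpow : (2 : ℂ) ^ (s / 2 - 1) * (2 : ℂ) ^ (1 - s) = (2 : ℂ) ^ (-s / 2) := by
    rw [← Complex.cpow_add _ _ two_ne_zero]
    ring_nf
  rw [mul_div_cancel₀ s two_ne_zero] at hdup
  rw [evenCoeff, gaussMoment, recipGamma, neg_neg, ← hpow]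
  generalize Complex.Gamma (s / 2 + 1 / 2) = G at *
  field_simp
  linear_combination -hdup

theorem oddCoeff_neg_mul_Gamma {s : ℂ} (hs : 0 < s.re) :
    oddCoeff (-s) * Complex.Gamma s = gaussMoment (s + 1) := by
  have hs1 : 0 < (s + 1).re := by
    rw [Complex.add_re, Complex.one_re]
    positivity
  have h := evenCoeff_neg_mul_Gamma hs1
  have hodd := oddCoeff_add_one (-s - 1)
  rw [sub_add_cancel] at hodd
  rw [Complex.Gamma_add_one s (Complex.ne_zero_of_re_pos hs), neg_add'] at h
  rw [hodd, ← h]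
  ring

theorem parabolicD_mul_Gamma {ν : ℂ} (hν : ν.re < 0) (x : ℝ) :
    parabolicD ν x * Complex.Gamma (-ν) = Complex.exp (-(x : ℂ) ^ 2 / 4) *
      ∫ t in Set.Ioi (0 : ℝ), gaussWeight (-ν) t * Complex.exp (-(x : ℂ) * t) := by
  have hs : 0 < (-ν).re := by simpa using hν
  rw [integral_gaussWeight_mul_exp hs, ← evenCoeff_neg_mul_Gamma hs, ← oddCoeff_neg_mul_Gamma hs,
    neg_neg, parabolicD_eq, yEven_eq, yOdd_eq]
  ring

/-! ### Decay at infinity -/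

/-- `g` decays at `+∞` faster than every power of `x`. -/
abbrev RapidDecay (g : ℝ → ℂ) : Prop :=
  Asymptotics.SuperpolynomialDecay Filter.atTop (fun x : ℝ => (x : ℂ)) g

theorem rapidDecay_of_norm_le {g : ℝ → ℂ} {C : ℝ}
    (h : ∀ x : ℝ, 0 ≤ x → ‖g x‖ ≤ C * Real.exp (-(1 / 4) * x ^ 2)) : RapidDecay g := by
  have hgauss : Asymptotics.SuperpolynomialDecay Filter.atTop (fun x : ℝ => x)
      fun x => Real.exp (-(1 / 4) * x ^ 2) := fun n => by
    have hexp : Filter.Tendsto (fun x : ℝ => Real.exp (-(1 / 2) * x)) Filter.atTop (nhds 0) :=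
      Real.tendsto_exp_atBot.comp
        (Filter.tendsto_id.const_mul_atTop_of_neg (by norm_num : -(1 / 2 : ℝ) < 0))
    simpa only [Real.rpow_natCast] using
      (rpow_mul_exp_neg_mul_sq_isLittleO_exp_neg (b := 1 / 4) (by norm_num) n).trans_tendsto hexp
  intro n
  refine squeeze_zero_norm' ?_ (by simpa only [mul_zero] using (hgauss n).const_mul C)
  filter_upwards [Filter.eventually_ge_atTop 0] with x hx
  rw [norm_mul, norm_pow, Complex.norm_real, Real.norm_of_nonneg hx, mul_left_comm]
  exact mul_le_mul_of_nonneg_left (h x hx) (by positivity)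

theorem rapidDecay_parabolicD_of_neg {ν : ℂ} (hν : ν.re < 0) :
    RapidDecay fun x : ℝ => parabolicD ν x := by
  have hs : 0 < (-ν).re := by simpa using hν
  have hΓ : Complex.Gamma (-ν) ≠ 0 := Complex.Gamma_ne_zero_of_re_pos hs
  refine rapidDecay_of_norm_le (C := (∫ t in Set.Ioi (0 : ℝ), ‖gaussWeight (-ν) t‖) /
    ‖Complex.Gamma (-ν)‖) fun x hx => ?_
  have hlaplace : ‖∫ t in Set.Ioi (0 : ℝ), gaussWeight (-ν) t * Complex.exp (-(x : ℂ) * t)‖ ≤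
      ∫ t in Set.Ioi (0 : ℝ), ‖gaussWeight (-ν) t‖ := by
    have hint := (integrableOn_gaussWeight_mul_exp hs 0).norm
    simp only [zero_mul, Real.exp_zero, Complex.ofReal_one, mul_one] at hint
    refine norm_integral_le_of_norm_le hint ?_
    filter_upwards [ae_restrict_mem measurableSet_Ioi] with t ht
    rw [norm_mul]
    refine mul_le_of_le_one_right (norm_nonneg _) ?_
    rw [← Complex.ofReal_neg, ← Complex.ofReal_mul, Complex.norm_exp_ofReal, Real.exp_le_one_iff,
      neg_mul, neg_nonpos]
    exact mul_nonneg hx (Set.mem_Ioi.1 ht).le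
  have hgauss : ‖Complex.exp (-(x : ℂ) ^ 2 / 4)‖ = Real.exp (-(1 / 4) * x ^ 2) := by
    rw [← Complex.norm_exp_ofReal]
    push_cast
    ring_nf
  rw [eq_div_of_mul_eq hΓ (parabolicD_mul_Gamma hν x), norm_div, norm_mul, hgauss,
    div_mul_eq_mul_div, mul_comm]
  gcongr

theorem rapidDecay_parabolicD (ν : ℂ) : RapidDecay fun x : ℝ => parabolicD ν x := by
  obtain ⟨m, hm⟩ := exists_nat_gt ν.re
  induction m generalizing ν with
  | zero => exact rapidDecay_parabolicD_of_neg (by simpa using hm)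
  | succ m ih =>
    push_cast at hm
    have h1 := ih (ν - 1) (by rw [Complex.sub_re, Complex.one_re]; linarith)
    have h2 := ih (ν - 1 - 1) (by rw [Complex.sub_re, Complex.sub_re, Complex.one_re]; linarith)
    refine (h1.param_mul.add (h2.const_mul (-(ν - 1)))).congr fun x => ?_
    have hladder := parabolicD_add_one (ν - 1) x
    rw [sub_add_cancel] at hladder
    simp only [hladder, Pi.add_apply, Pi.mul_apply]
    ring

theorem rapidDecay_parabolicDDeriv (ν : ℂ) : RapidDecay fun x : ℝ => parabolicDDeriv ν x := by
  refine (((rapidDecay_parabolicD ν).param_mul.const_mul (-(1 / 2))).add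
    ((rapidDecay_parabolicD (ν - 1)).const_mul ν)).congr fun x => ?_
  simp only [parabolicDDeriv_eq, Pi.add_apply, Pi.mul_apply]
  ring

theorem RapidDecay.memLp_Ioi {g : ℝ → ℂ} (hg : RapidDecay g) (hc : Continuous g) (a : ℝ) :
    MemLp g 2 (volume.restrict (Set.Ioi a)) := by
  rw [memLp_two_iff_integrable_sq_norm hc.aestronglyMeasurable]
  have hl : LocallyIntegrableOn (fun x => ‖g x‖ ^ 2) (Set.Ici a) :=
    (hc.norm.pow 2).locallyIntegrable.locallyIntegrableOn _
  refine (hl.integrableOn_of_isBigO_atTop (g := fun x : ℝ => x ^ (-2 : ℝ)) ?_ ?_).mono_set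
    Set.Ioi_subset_Ici_self
  · refine Asymptotics.IsBigO.of_bound 1 ?_
    filter_upwards [(hg 1).norm.eventually_le_const (by simp : ‖(0 : ℂ)‖ < 1),
      Filter.eventually_gt_atTop 0] with x hx h0
    rw [pow_one, norm_mul, Complex.norm_real, Real.norm_of_nonneg h0.le] at hx
    rw [Real.norm_of_nonneg (by positivity), Real.norm_of_nonneg (by positivity), one_mul,
      Real.rpow_neg h0.le, Real.rpow_two, ← one_div, le_div_iff₀ (by positivity), ← mul_pow,
      mul_comm]
    exact pow_le_one₀ (by positivity) hx
  · rw [integrableAtFilter_rpow_atTop_iff]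
    norm_num

/-! ### Primitives of locally integrable functions -/

/-- `G` is a locally absolutely continuous function with almost everywhere derivative `g`, expressed
through the fundamental theorem of calculus. -/
structure IsPrimitive {E : Type*} [NormedAddCommGroup E] [NormedSpace ℝ E] (G g : ℝ → E) :
    Prop where
  locallyIntegrable : LocallyIntegrable g
  integral_eq : ∀ x y, ∫ t in x..y, g t = G y - G x

namespace IsPrimitive

section NormedSpace

variable {E : Type*} [NormedAddCommGroup E] [NormedSpace ℝ E] {G H g h : ℝ → E}

theorem intervalIntegrable (hG : IsPrimitive G g) (x y : ℝ) : IntervalIntegrable g volume x y :=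
  (hG.locallyIntegrable.integrableOn_isCompact isCompact_uIcc).intervalIntegrable

theorem of_integral_eq (c : ℝ) (hg : LocallyIntegrable g)
    (hG : ∀ x, ∫ t in c..x, g t = G x - G c) : IsPrimitive G g := by
  have hint : ∀ x, IntervalIntegrable g volume c x := fun x =>
    (hg.integrableOn_isCompact isCompact_uIcc).intervalIntegrable
  refine ⟨hg, fun x y => ?_⟩
  rw [← intervalIntegral.integral_interval_sub_left (hint y) (hint x), hG, hG,
    sub_sub_sub_cancel_right]

theorem integral (hg : LocallyIntegrable g) (c : ℝ) :
    IsPrimitive (fun x => ∫ t in c..x, g t) g :=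
  of_integral_eq c hg fun x => by rw [intervalIntegral.integral_same, sub_zero]

theorem of_hasDerivAt [CompleteSpace E] (hG : ∀ x, HasDerivAt G (g x) x) (hg : Continuous g) :
    IsPrimitive G g :=
  ⟨hg.locallyIntegrable, fun x y => intervalIntegral.integral_eq_sub_of_hasDerivAt
    (fun t _ => hG t) (hg.intervalIntegrable x y)⟩

theorem zero_right [CompleteSpace E] (c : E) : IsPrimitive (fun _ => c) 0 :=
  of_hasDerivAt (fun x => hasDerivAt_const x c) continuous_zero

theorem eq_add_integral (hG : IsPrimitive G g) (c x : ℝ) : G x = G c + ∫ t in c..x, g t := by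
  rw [hG.integral_eq, add_sub_cancel]

theorem continuous (hG : IsPrimitive G g) : Continuous G := by
  rw [funext (hG.eq_add_integral 0)]
  exact continuous_const.add (intervalIntegral.continuous_primitive hG.intervalIntegrable 0)

theorem ae_hasDerivAt [CompleteSpace E] (hG : IsPrimitive G g) :
    ∀ᵐ x, HasDerivAt G (g x) x := by
  filter_upwards [LocallyIntegrable.ae_hasDerivAt_integral hG.locallyIntegrable] with x hx
  rw [funext (hG.eq_add_integral 0)]
  exact (hx 0).const_add _

theorem congr_ae (hG : IsPrimitive G g) (hgh : g =ᵐ[volume] h) : IsPrimitive G h := by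
  refine ⟨hG.locallyIntegrable.congr hgh, fun x y => ?_⟩
  rw [← hG.integral_eq]
  exact intervalIntegral.integral_congr_ae (hgh.mono fun t ht _ => ht.symm)

theorem add (hG : IsPrimitive G g) (hH : IsPrimitive H h) : IsPrimitive (G + H) (g + h) := by
  refine ⟨hG.locallyIntegrable.add hH.locallyIntegrable, fun x y => ?_⟩
  simp only [Pi.add_apply]
  rw [intervalIntegral.integral_add (hG.intervalIntegrable x y) (hH.intervalIntegrable x y),
    hG.integral_eq, hH.integral_eq]
  abel

theorem comp_clm [CompleteSpace E] {F : Type*} [NormedAddCommGroup F] [NormedSpace ℝ F]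
    [CompleteSpace F] (L : E →L[ℝ] F) (hG : IsPrimitive G g) :
    IsPrimitive (fun x => L (G x)) (fun x => L (g x)) := by
  refine ⟨fun x => ?_, fun x y => ?_⟩
  · obtain ⟨s, hs, hgs⟩ := hG.locallyIntegrable x
    exact ⟨s, hs, L.integrable_comp hgs⟩
  · rw [L.intervalIntegral_comp_comm (hG.intervalIntegrable x y), hG.integral_eq, map_sub]

theorem neg [CompleteSpace E] (hG : IsPrimitive G g) : IsPrimitive (-G) (-g) :=
  hG.comp_clm (-ContinuousLinearMap.id ℝ E)

theorem sub [CompleteSpace E] (hG : IsPrimitive G g) (hH : IsPrimitive H h) :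
    IsPrimitive (G - H) (g - h) := by
  simpa only [sub_eq_add_neg] using hG.add hH.neg

theorem piecewise_Iic {c : ℝ} (hG : IsPrimitive G g) (hH : IsPrimitive H h) (hc : G c = H c) :
    IsPrimitive ((Set.Iic c).piecewise G H) ((Set.Iic c).piecewise g h) := by
  refine of_integral_eq c ?_ fun x => ?_
  · rw [← Set.indicator_add_compl_eq_piecewise]
    exact (hG.locallyIntegrable.indicator measurableSet_Iic).add
      (hH.locallyIntegrable.indicator measurableSet_Iic.compl)
  · rw [Set.piecewise_eq_of_mem (Set.Iic c) G H Set.self_mem_Iic]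
    rcases le_or_gt x c with hx | hx
    · rw [Set.piecewise_eq_of_mem (Set.Iic c) G H hx, ← hG.integral_eq]
      refine intervalIntegral.integral_congr fun t ht => Set.piecewise_eq_of_mem _ _ _ ?_
      rw [Set.uIcc_of_ge hx] at ht
      exact ht.2
    · rw [Set.piecewise_eq_of_notMem (Set.Iic c) G H (Set.notMem_Iic.2 hx), hc, ← hH.integral_eq]
      refine intervalIntegral.integral_congr_ae (.of_forall fun t ht =>
        Set.piecewise_eq_of_notMem _ _ _ ?_)
      rw [Set.uIoc_of_le hx.le] at ht
      exact Set.notMem_Iic.2 ht.1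

theorem integral_Ioi_eq_sub {a : ℝ} {c : E} (hG : IsPrimitive G g) (hg : IntegrableOn g (Set.Ioi a))
    (hc : IntegrableOn (fun x => G x - c) (Set.Ioi a)) : ∫ x in Set.Ioi a, g x = c - G a := by
  have hlim := intervalIntegral_tendsto_integral_Ioi a hg Filter.tendsto_id
  simp only [id_eq, hG.integral_eq] at hlim
  have hzero := IntegrableAtFilter.eq_zero_of_tendsto
    (⟨Set.Ioi a, Filter.Ioi_mem_atTop a, hc⟩ : IntegrableAtFilter _ Filter.atTop volume)
    (fun s hs => ?_) ((hlim.add_const (G a - c)).congr fun x => by abel)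
  · rw [eq_neg_of_add_eq_zero_left hzero, neg_sub]
  · obtain ⟨M, hM⟩ := Filter.mem_atTop_sets.1 hs
    exact top_le_iff.1 (Real.volume_Ici (a := M) ▸ measure_mono hM)

theorem integral_Iic_eq_sub {a : ℝ} {c : E} (hG : IsPrimitive G g) (hg : IntegrableOn g (Set.Iic a))
    (hc : IntegrableOn (fun x => G x - c) (Set.Iic a)) : ∫ x in Set.Iic a, g x = G a - c := by
  have hlim := intervalIntegral_tendsto_integral_Iic a hg Filter.tendsto_id
  simp only [id_eq, hG.integral_eq] at hlim
  have hzero := IntegrableAtFilter.eq_zero_of_tendsto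
    (⟨Set.Iic a, Filter.Iic_mem_atBot a, hc⟩ : IntegrableAtFilter _ Filter.atBot volume)
    (fun s hs => ?_) ((hlim.const_sub (G a - c)).congr fun x => by abel)
  · exact (sub_eq_zero.1 hzero).symm
  · obtain ⟨M, hM⟩ := Filter.mem_atBot_sets.1 hs
    exact top_le_iff.1 (Real.volume_Iic (a := M) ▸ measure_mono hM)

end NormedSpace

theorem ofReal_mul {G g H h : ℝ → ℝ} (hG : IsPrimitive G g) (hH : IsPrimitive H h) :
    IsPrimitive (G * H) (g * H + G * h) := by
  have hac : ∀ {F f : ℝ → ℝ}, IsPrimitive F f → ∀ x y, AbsolutelyContinuousOnInterval F x y :=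
    fun {F f} hF x y => by
      have hconst := (contDiff_const (c := F x)).contDiffOn.absolutelyContinuousOnInterval
        (a := x) (b := y)
      have hint := (hF.intervalIntegrable x y).absolutelyContinuousOnInterval_intervalIntegral
        (c := x) Set.left_mem_uIcc
      rw [funext (hF.eq_add_integral x)]
      exact hconst.add hint
  refine ⟨(hG.locallyIntegrable.mul_continuous hH.continuous).add
    (hH.locallyIntegrable.continuous_mul hG.continuous), fun x y => ?_⟩
  rw [Pi.mul_apply, Pi.mul_apply,
    ← (hac hG x y).integral_deriv_mul_eq_sub (hac hH x y)]
  refine intervalIntegral.integral_congr_ae ?_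
  filter_upwards [hG.ae_hasDerivAt, hH.ae_hasDerivAt] with t hGt hHt _
  rw [hGt.deriv, hHt.deriv, Pi.add_apply, Pi.mul_apply, Pi.mul_apply]

theorem comp_conj {G g : ℝ → ℂ} (hG : IsPrimitive G g) :
    IsPrimitive (fun x => conj (G x)) (fun x => conj (g x)) :=
  hG.comp_clm Complex.conjCLE.toContinuousLinearMap

theorem const_mul {G g : ℝ → ℂ} (c : ℂ) (hG : IsPrimitive G g) :
    IsPrimitive (fun x => c * G x) (fun x => c * g x) :=
  hG.comp_clm (ContinuousLinearMap.mul ℝ ℂ c)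

theorem mul {G g H h : ℝ → ℂ} (hG : IsPrimitive G g) (hH : IsPrimitive H h) :
    IsPrimitive (G * H) (g * H + G * h) := by
  have hre := (hG.comp_clm Complex.reCLM).ofReal_mul (hH.comp_clm Complex.reCLM)
  have him := (hG.comp_clm Complex.imCLM).ofReal_mul (hH.comp_clm Complex.imCLM)
  have hreim := (hG.comp_clm Complex.reCLM).ofReal_mul (hH.comp_clm Complex.imCLM)
  have himre := (hG.comp_clm Complex.imCLM).ofReal_mul (hH.comp_clm Complex.reCLM)
  have key := ((hre.sub him).comp_clm Complex.ofRealCLM).add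
    (((hreim.add himre).comp_clm Complex.ofRealCLM).const_mul Complex.I)
  convert key using 1 <;> ext x <;> apply Complex.ext <;> simp <;> ring

end IsPrimitive

/-! ### Gluing at `±b` -/

/-- The function equal to `fl` on `(-∞, -b]`, to `fm` on `(-b, b]` and to `fr` on `(b, ∞)`. -/
def glue (b : ℝ) (fl fm fr : ℝ → ℂ) : ℝ → ℂ :=
  (Set.Iic (-b)).piecewise fl ((Set.Iic b).piecewise fm fr)

/-- The step function which is `cl` on `(-∞, -b]`, `0` on `(-b, b]` and `cr` on `(b, ∞)`. It
carries the jumps of the derivative that are produced by the point interactions. -/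
def jump (b : ℝ) (cl cr : ℂ) : ℝ → ℂ := glue b (fun _ => cl) 0 (fun _ => cr)

theorem glue_of_le {b x : ℝ} (fl fm fr : ℝ → ℂ) (hx : x ≤ -b) : glue b fl fm fr x = fl x :=
  Set.piecewise_eq_of_mem _ _ _ hx

theorem glue_of_mem_Ioc {b x : ℝ} (fl fm fr : ℝ → ℂ) (hx : x ∈ Set.Ioc (-b) b) :
    glue b fl fm fr x = fm x := by
  rw [glue, Set.piecewise_eq_of_notMem _ _ _ (Set.notMem_Iic.2 hx.1),
    Set.piecewise_eq_of_mem (Set.Iic b) _ _ hx.2]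

theorem glue_of_lt {b x : ℝ} (fl fm fr : ℝ → ℂ) (hb : 0 ≤ b) (hx : b < x) :
    glue b fl fm fr x = fr x := by
  rw [glue, Set.piecewise_eq_of_notMem _ _ _ (Set.notMem_Iic.2 (by linarith)),
    Set.piecewise_eq_of_notMem _ _ _ (Set.notMem_Iic.2 hx)]

theorem IsPrimitive.glue {b : ℝ} {Gl Gm Gr gl gm gr : ℝ → ℂ} (hb : 0 ≤ b) (hl : IsPrimitive Gl gl)
    (hm : IsPrimitive Gm gm) (hr : IsPrimitive Gr gr) (hleft : Gl (-b) = Gm (-b))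
    (hright : Gm b = Gr b) : IsPrimitive (glue b Gl Gm Gr) (glue b gl gm gr) := by
  refine hl.piecewise_Iic (hm.piecewise_Iic hr hright) ?_
  rwa [Set.piecewise_eq_of_mem _ _ _ (Set.mem_Iic.2 (by linarith))]

theorem IsPrimitive.jump_mul {b : ℝ} {G g : ℝ → ℂ} (hb : 0 ≤ b) (hG : IsPrimitive G g)
    (cl cr : ℂ) :
    IsPrimitive (jump b cl cr * G - jump b (cl * G (-b)) (cr * G b)) (jump b cl cr * g) := by
  have key := IsPrimitive.glue (b := b) hb ((hG.sub (zero_right (G (-b)))).const_mul cl)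
    (zero_right 0) ((hG.sub (zero_right (G b))).const_mul cr) (by simp) (by simp)
  convert key using 1 <;> ext x <;>
    simp only [jump, OddPair.glue, Set.piecewise, Pi.sub_apply, Pi.mul_apply, Pi.zero_apply] <;>
    split_ifs <;> ring

theorem integral_mul_add_jump_mul {b : ℝ} {cl cr : ℂ} {G g P p : ℝ → ℂ} (hb : 0 ≤ b)
    (hG : IsPrimitive G g) (hP : IsPrimitive P p)
    (hderiv : Integrable (p * G + (P + jump b cl cr) * g))
    (hprod : Integrable ((P + jump b cl cr) * G)) :
    ∫ x, (p * G + (P + jump b cl cr) * g) x = cl * G (-b) - cr * G b := by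
  have hW : IsPrimitive (P * G + (jump b cl cr * G - jump b (cl * G (-b)) (cr * G b)))
      (p * G + (P + jump b cl cr) * g) := by
    rw [add_mul, ← add_assoc]
    exact (hP.mul hG).add (hG.jump_mul hb cl cr)
  have hright := hW.integral_Ioi_eq_sub (a := b) (c := -(cr * G b)) hderiv.integrableOn
    (hprod.integrableOn.congr_fun (fun x hx => by
      simp only [jump, Pi.add_apply, Pi.sub_apply, Pi.mul_apply, glue_of_lt _ _ _ hb hx]
      ring) measurableSet_Ioi)
  have hleft := hW.integral_Iic_eq_sub (a := -b) (c := -(cl * G (-b))) hderiv.integrableOn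
    (hprod.integrableOn.congr_fun (fun x hx => by
      simp only [jump, Pi.add_apply, Pi.sub_apply, Pi.mul_apply, glue_of_le _ _ _ hx]
      ring) measurableSet_Iic)
  have hmiddle := hW.integral_eq (-b) b
  rw [← intervalIntegral.integral_Iic_sub_Iic hderiv.integrableOn hderiv.integrableOn] at hmiddle
  rw [← intervalIntegral.integral_Iic_add_Ioi hderiv.integrableOn hderiv.integrableOn (b := b),
    hright, eq_add_of_sub_eq hmiddle, hleft]
  ring

/-! ### Continuous representatives -/

theorem integrable_deriv_smul {G : ℝ → ℂ} {φ : ℝ → ℝ} (hG : Continuous G) (hφ : ContDiff ℝ ∞ φ)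
    (hc : HasCompactSupport φ) : Integrable (fun x => deriv φ x • G x) :=
  ((continuous_deriv_of_smooth hφ).smul hG).integrable_of_hasCompactSupport hc.deriv.smul_right

theorem integral_deriv_smul_eq_neg {G g : ℝ → ℂ} {φ : ℝ → ℝ} (hG : IsPrimitive G g)
    (hφ : ContDiff ℝ ∞ φ) (hc : HasCompactSupport φ) :
    ∫ x, deriv φ x • G x = -∫ x, φ x • g x := by
  have hφ0 : ∫ x, deriv φ x = 0 := integral_eq_zero_of_hasDerivAt_of_integrable
    (fun x => (hφ.differentiable (by simp) x).hasDerivAt)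
    ((continuous_deriv_of_smooth hφ).integrable_of_hasCompactSupport hc.deriv)
    (hφ.continuous.integrable_of_hasCompactSupport hc)
  have hsplit : (fun x => deriv φ x • G x) =
      fun x => deriv φ x • G 0 + deriv φ x • ∫ t in (0 : ℝ)..x, g t :=
    funext fun x => by rw [← smul_add, ← hG.eq_add_integral 0]
  rw [hsplit, integral_add (integrable_deriv_smul continuous_const hφ hc)
      (integrable_deriv_smul (IsPrimitive.integral hG.locallyIntegrable 0).continuous hφ hc),
    integral_smul_const, hφ0, zero_smul, zero_add,
    integral_deriv_smul_primitive hG.locallyIntegrable hφ hc]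

theorem exists_isPrimitive_of_hasWeakDeriv {v p : ℝ → ℂ} (hv : LocallyIntegrable v)
    (hp : LocallyIntegrable p)
    (h : ∀ φ : ℝ → ℝ, ContDiff ℝ ∞ φ → HasCompactSupport φ →
      ∫ x, deriv φ x • v x = -∫ x, φ x • p x) :
    ∃ P, IsPrimitive P p ∧ v =ᵐ[volume] P := by
  have hint := IsPrimitive.integral hp 0
  obtain ⟨c, hc⟩ := ae_const_of_weakDeriv_zero
    (v := fun x => v x - ∫ t in (0 : ℝ)..x, p t)
    (hv.sub hint.continuous.locallyIntegrable) fun φ hφ hcs => by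
      have hd := continuous_deriv_of_smooth hφ
      simp_rw [smul_sub]
      rw [integral_sub (hv.integrable_smul_left_of_hasCompactSupport hd hcs.deriv)
          (integrable_deriv_smul hint.continuous hφ hcs), h φ hφ hcs,
        integral_deriv_smul_eq_neg hint hφ hcs, sub_self]
  refine ⟨_, (by simpa only [zero_add] using (IsPrimitive.zero_right c).add hint), ?_⟩
  filter_upwards [hc] with x hx
  exact sub_eq_iff_eq_add.1 hx

theorem isPrimitive_contRep {f : L2} (hf : f ∈ sobolevH1) :
    IsPrimitive (contRep f) (weakDeriv f) := by
  obtain ⟨F, hF, hfF⟩ := exists_isPrimitive_of_hasWeakDeriv (L2.locallyIntegrable f)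
    (L2.locallyIntegrable (weakDeriv f)) (hasWeakDeriv_weakDeriv hf)
  rwa [contRep_eq hF.continuous hfF]

theorem IsPrimitive.hasWeakDeriv {f g : L2} {F : ℝ → ℂ} (hF : IsPrimitive F g)
    (hf : f =ᵐ[volume] F) : HasWeakDeriv f g := fun φ hφ hc => by
  rw [← integral_deriv_smul_eq_neg hF hφ hc]
  refine integral_congr_ae ?_
  filter_upwards [hf] with x hx
  rw [hx]

theorem contRep_add {f g : L2} (hf : f ∈ sobolevH1) (hg : g ∈ sobolevH1) :
    contRep (f + g) = contRep f + contRep g :=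
  contRep_eq ((contRep_spec hf).1.add (contRep_spec hg).1)
    ((Lp.coeFn_add f g).trans ((contRep_spec hf).2.add (contRep_spec hg).2))

theorem contRep_smul (a : ℂ) {f : L2} (hf : f ∈ sobolevH1) :
    contRep (a • f) = a • contRep f :=
  contRep_eq ((contRep_spec hf).1.const_smul a)
    ((Lp.coeFn_smul a f).trans ((contRep_spec hf).2.const_smul a))

theorem memLp_contRep {f : L2} (hf : f ∈ sobolevH1) : MemLp (contRep f) 2 volume :=
  (Lp.memLp f).ae_eq (contRep_spec hf).2

theorem integral_norm_mul_norm_le (f g : L2) : ∫ x, ‖f x‖ * ‖g x‖ ≤ ‖f‖ * ‖g‖ := by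
  calc ∫ x, ‖f x‖ * ‖g x‖ = ‖(f • g : Lp ℂ 1 volume)‖ := by
        rw [L1.norm_eq_integral_norm]
        refine integral_congr_ae ?_
        filter_upwards [Lp.coeFn_lpSMul (r := 1) f g] with x hx
        rw [hx, Pi.smul_apply', smul_eq_mul, norm_mul]
    _ ≤ ‖f‖ * ‖g‖ := Lp.norm_smul_le f g

theorem norm_contRep_sq_le {f : L2} (hf : f ∈ sobolevH1) (a : ℝ) :
    ‖contRep f a‖ ^ 2 ≤ 2 * (‖f‖ * ‖weakDeriv f‖) := by
  have hF := isPrimitive_contRep hf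
  have hrep := memLp_contRep hf
  have hmul : Integrable (fun x => ‖f x‖ * ‖weakDeriv f x‖) :=
    (Lp.memLp f).norm.integrable_mul (Lp.memLp (weakDeriv f)).norm
  have hderiv := ((Lp.memLp (weakDeriv f)).integrable_mul hrep.star).add
    (hrep.integrable_mul (Lp.memLp (weakDeriv f)).star)
  have key := (hF.mul hF.comp_conj).integral_Ioi_eq_sub (a := a) (c := 0) hderiv.integrableOn
    (by simpa only [sub_zero] using! (hrep.integrable_mul hrep.star).integrableOn)
  calc ‖contRep f a‖ ^ 2
      = ‖∫ x in Set.Ioi a, (weakDeriv f x * conj (contRep f x) +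
          contRep f x * conj (weakDeriv f x))‖ := by
        rw [sq, ← congrArg (‖contRep f a‖ * ·) (RCLike.norm_conj (contRep f a)), ← norm_mul,
          ← norm_neg, ← zero_sub]
        exact congrArg norm key.symm
    _ ≤ ∫ x in Set.Ioi a, 2 * (‖f x‖ * ‖weakDeriv f x‖) := by
        refine norm_integral_le_of_norm_le (hmul.const_mul 2).integrableOn
          (ae_restrict_of_ae ?_)
        filter_upwards [(contRep_spec hf).2] with x hx
        rw [← hx]
        refine (norm_add_le _ _).trans_eq ?_
        rw [norm_mul, norm_mul, RCLike.norm_conj, RCLike.norm_conj]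
        ring
    _ ≤ ∫ x, 2 * (‖f x‖ * ‖weakDeriv f x‖) :=
        setIntegral_le_integral (hmul.const_mul 2) (.of_forall fun x => by positivity)
    _ ≤ 2 * (‖f‖ * ‖weakDeriv f‖) := by
        rw [integral_const_mul]
        exact mul_le_mul_of_nonneg_left (integral_norm_mul_norm_le f _) zero_le_two

theorem exists_mem_formDomain_contRep_eq {φ : ℝ → ℝ} (hφ : ContDiff ℝ ∞ φ)
    (hc : HasCompactSupport φ) : ∃ g ∈ formDomain, (contRep g = fun x => (φ x : ℂ)) ∧
      weakDeriv g =ᵐ[volume] fun x => ((deriv φ x : ℝ) : ℂ) := by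
  obtain ⟨g, hg, hgφ⟩ := exists_mem_formDomain hφ hc
  have hrep : contRep g = fun x => (φ x : ℂ) :=
    contRep_eq (Complex.continuous_ofReal.comp hφ.continuous) hgφ
  refine ⟨g, hg, hrep, ?_⟩
  filter_upwards [(isPrimitive_contRep hg.1).ae_hasDerivAt] with x hx
  rw [hrep] at hx
  exact hx.unique (hφ.differentiable (by simp) x).hasDerivAt.ofReal_comp

/-! ### The domain of the operator -/

/-- The potential `x²/4 - 1/2` of the operator away from the point interactions. -/
def potential (x : ℝ) : ℂ := (x : ℂ) ^ 2 / 4 - 1 / 2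

theorem continuous_potential : Continuous potential := by
  unfold potential
  fun_prop

/-- The integrand of `form z b f g - inner ℂ g k` without its boundary terms. -/
def formIntegrand (f k g : L2) (x : ℝ) : ℂ :=
  (potential x * contRep f x - k x) * conj (contRep g x) + weakDeriv f x * conj (weakDeriv g x)

theorem formIntegrand_ae_eq {f g : L2} (hf : f ∈ formDomain) (hg : g ∈ formDomain) (k : L2) :
    formIntegrand f k g =ᵐ[volume] (fun x => inner ℂ (weakDeriv g x) (weakDeriv f x)) +
      (fun x : ℝ => 1 / 4 * (((x : ℂ) * f x) * conj ((x : ℂ) * g x))) -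
      (fun x => 1 / 2 * inner ℂ (g x) (f x)) - fun x => inner ℂ (g x) (k x) := by
  filter_upwards [(contRep_spec hf.1).2, (contRep_spec hg.1).2] with x hfx hgx
  rw [formIntegrand, ← hfx, ← hgx, potential]
  simp only [Pi.add_apply, Pi.sub_apply, RCLike.inner_apply, map_mul, Complex.conj_ofReal]
  ring

theorem integrable_formIntegrand {f g : L2} (hf : f ∈ formDomain) (hg : g ∈ formDomain) (k : L2) :
    Integrable (formIntegrand f k g) :=
  ((((L2.integrable_inner _ _).add ((integrable_weight hf hg).const_mul _)).sub
    ((L2.integrable_inner _ _).const_mul _)).sub (L2.integrable_inner _ _)).congr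
    (formIntegrand_ae_eq hf hg k).symm

theorem form_sub_inner_eq (z : ℂ) (b : ℝ) {f g : L2} (hf : f ∈ formDomain) (hg : g ∈ formDomain)
    (k : L2) :
    form z b f g - inner ℂ g k = (∫ x, formIntegrand f k g x) +
      z * (contRep f b * conj (contRep g b) - contRep f (-b) * conj (contRep g (-b))) := by
  have hderiv := L2.integrable_inner (𝕜 := ℂ) (weakDeriv g) (weakDeriv f)
  have hweight := (integrable_weight hf hg).const_mul (1 / 4)
  have hinner := (L2.integrable_inner (𝕜 := ℂ) g f).const_mul (1 / 2)
  rw [integral_congr_ae (formIntegrand_ae_eq hf hg k),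
    integral_sub' ((hderiv.add hweight).sub hinner) (L2.integrable_inner g k),
    integral_sub' (hderiv.add hweight) hinner, integral_add' hderiv hweight, integral_const_mul,
    integral_const_mul, form, L2.inner_def, L2.inner_def, L2.inner_def]
  ring

theorem locallyIntegrable_jump {b : ℝ} (hb : 0 ≤ b) (cl cr : ℂ) :
    LocallyIntegrable (jump b cl cr) := by
  have hid : IsPrimitive (fun x : ℝ => (x : ℂ)) 1 :=
    .of_hasDerivAt (fun x => (hasDerivAt_id x).ofReal_comp) continuous_one
  simpa only [mul_one] using (hid.jump_mul hb cl cr).locallyIntegrable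

theorem mem_operatorGraph_of_jump {z : ℂ} {b : ℝ} (hb : 0 ≤ b) {f k : L2} (hf : f ∈ formDomain)
    {P : ℝ → ℂ} (hP : IsPrimitive P fun x => potential x * contRep f x - k x)
    (hderiv : weakDeriv f =ᵐ[volume] P + jump b (z * contRep f (-b)) (z * contRep f b)) :
    (f, k) ∈ operatorGraph z b := by
  refine ⟨hf, fun g hg => sub_eq_zero.1 ?_⟩
  have hG := (isPrimitive_contRep hg.1).comp_conj
  have hintegrand : formIntegrand f k g =ᵐ[volume]
      (fun x => potential x * contRep f x - k x) * (fun x => conj (contRep g x)) +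
        (P + jump b (z * contRep f (-b)) (z * contRep f b)) * fun x => conj (weakDeriv g x) := by
    filter_upwards [hderiv] with x hx
    rw [formIntegrand, hx]
    rfl
  rw [form_sub_inner_eq z b hf hg, integral_congr_ae hintegrand,
    integral_mul_add_jump_mul hb hG hP ((integrable_formIntegrand hf hg k).congr hintegrand)]
  · ring
  · exact ((Lp.memLp (weakDeriv f)).integrable_mul (memLp_contRep hg.1).star).congr
      (hderiv.mul (ae_eq_refl _))

theorem integral_deriv_smul_jump {b : ℝ} (hb : 0 ≤ b) (cl cr : ℂ) {φ : ℝ → ℝ}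
    (hφ : ContDiff ℝ ∞ φ) (hc : HasCompactSupport φ) :
    ∫ x, deriv φ x • jump b cl cr x = cl * φ (-b) - cr * φ b := by
  have hprim : IsPrimitive (fun x => (φ x : ℂ)) fun x => ((deriv φ x : ℝ) : ℂ) :=
    .of_hasDerivAt (fun x => (hφ.differentiable (by simp) x).hasDerivAt.ofReal_comp)
      (Complex.continuous_ofReal.comp (continuous_deriv_of_smooth hφ))
  have hJ := locallyIntegrable_jump hb cl cr
  have hsum : ∀ G H : ℝ → ℂ, 0 * G + ((fun _ => 0) + jump b cl cr) * H =
      fun x => H x * jump b cl cr x := fun G H => by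
    ext x
    rw [zero_mul, zero_add, Pi.mul_apply, Pi.add_apply, zero_add, mul_comm]
  have hdφ := continuous_deriv_of_smooth hφ
  have key := integral_mul_add_jump_mul (cl := cl) (cr := cr) hb hprim (.zero_right 0)
    (by
      rw [hsum]
      exact hJ.integrable_smul_left_of_hasCompactSupport hdφ hc.deriv)
    (by
      rw [← zero_add (_ * _), ← zero_mul 0, hsum]
      exact hJ.integrable_smul_left_of_hasCompactSupport hφ.continuous hc)
  rwa [hsum] at key

theorem exists_jump_of_mem_operatorGraph {z : ℂ} {b : ℝ} (hb : 0 ≤ b) {f k : L2}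
    (hfk : (f, k) ∈ operatorGraph z b) :
    ∃ P, IsPrimitive P (fun x => potential x * contRep f x - k x) ∧
      weakDeriv f =ᵐ[volume] P + jump b (z * contRep f (-b)) (z * contRep f b) := by
  obtain ⟨hf, hform⟩ := hfk
  set J := jump b (z * contRep f (-b)) (z * contRep f b)
  have hJ : LocallyIntegrable J := locallyIntegrable_jump hb _ _
  have hp : LocallyIntegrable fun x => potential x * contRep f x - k x :=
    (continuous_potential.mul (contRep_spec hf.1).1).locallyIntegrable.sub
      (L2.locallyIntegrable k)
  obtain ⟨P, hP, hderiv⟩ := exists_isPrimitive_of_hasWeakDeriv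
    ((L2.locallyIntegrable (weakDeriv f)).sub hJ) hp fun φ hφ hc => by
      obtain ⟨g, hg, hgφ, hdg⟩ := exists_mem_formDomain_contRep_eq hφ hc
      have hdφ := continuous_deriv_of_smooth hφ
      have htest : ∫ x, formIntegrand f k g x =
          ∫ x, φ x • (potential x * contRep f x - k x) + deriv φ x • weakDeriv f x := by
        refine integral_congr_ae ?_
        filter_upwards [hdg] with x hx
        rw [formIntegrand, hx, hgφ]
        simp only [Complex.conj_ofReal, Complex.real_smul, mul_comm]
      have hzero := form_sub_inner_eq z b hf hg k
      rw [hform g hg, sub_self, hgφ, htest,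
        integral_add (hp.integrable_smul_left_of_hasCompactSupport hφ.continuous hc)
          (L2.integrable_smul _ hdφ hc.deriv)] at hzero
      simp only [Complex.conj_ofReal] at hzero
      simp_rw [Pi.sub_apply, smul_sub (deriv φ _) (weakDeriv f _)]
      rw [integral_sub (L2.integrable_smul _ hdφ hc.deriv)
        (hJ.integrable_smul_left_of_hasCompactSupport hdφ hc.deriv),
        integral_deriv_smul_jump hb _ _ hφ hc]
      linear_combination -hzero
  refine ⟨P, hP, ?_⟩
  filter_upwards [hderiv] with x hx
  exact sub_eq_iff_eq_add.1 hx

/-! ### The form domain as a Hilbert space -/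

theorem continuous_integral_smul {ψ : ℝ → ℝ} (hψ : Continuous ψ) (hc : HasCompactSupport ψ) :
    Continuous fun f : L2 => ∫ x, ψ x • f x := by
  have hψ2 : MemLp (fun x => (ψ x : ℂ)) 2 volume :=
    (Complex.continuous_ofReal.comp hψ).memLp_of_hasCompactSupport
      (hc.comp_left Complex.ofReal_zero)
  have hinner : (fun f : L2 => ∫ x, ψ x • f x) = fun f : L2 => inner ℂ (hψ2.toLp _) f := by
    ext f
    rw [L2.inner_def]
    refine integral_congr_ae ?_
    filter_upwards [hψ2.coeFn_toLp] with x hx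
    rw [hx, RCLike.inner_apply, Complex.conj_ofReal, Complex.real_smul, mul_comm]
  rw [hinner]
  exact continuous_const.inner continuous_id

theorem isClosed_hasWeakDeriv : IsClosed {p : L2 × L2 | HasWeakDeriv p.1 p.2} := by
  simp only [HasWeakDeriv, Set.ofPred_forall]
  refine isClosed_iInter fun φ => isClosed_iInter fun hφ => isClosed_iInter fun hc => ?_
  exact isClosed_eq
    ((continuous_integral_smul (continuous_deriv_of_smooth hφ) hc.deriv).comp continuous_fst)
    ((continuous_integral_smul hφ.continuous hc).comp continuous_snd).neg

theorem ae_eq_ofReal_mul_iff (f g : L2) :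
    (g =ᵐ[volume] fun x : ℝ => (x : ℂ) * f x) ↔ ∀ φ : ℝ → ℝ, ContDiff ℝ ∞ φ →
      HasCompactSupport φ → ∫ x, φ x • g x = ∫ x, (φ x * x) • f x := by
  have hsmul : ∀ (φ : ℝ → ℝ) (x : ℝ), (φ x * x) • f x = φ x • ((x : ℂ) * f x) :=
    fun φ x => by rw [mul_smul, Complex.real_smul (x := x)]
  simp_rw [hsmul]
  refine ⟨fun hg φ _ _ => integral_congr_ae ?_, fun hg => ?_⟩
  · filter_upwards [hg] with x hx
    rw [hx]
  · exact ae_eq_of_integral_contDiff_smul_eq (L2.locallyIntegrable g)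
      ((L2.locallyIntegrable f).continuous_mul Complex.continuous_ofReal) hg

theorem isClosed_ae_eq_ofReal_mul :
    IsClosed {p : L2 × L2 | p.2 =ᵐ[volume] fun x : ℝ => (x : ℂ) * p.1 x} := by
  simp only [ae_eq_ofReal_mul_iff, Set.ofPred_forall]
  refine isClosed_iInter fun φ => isClosed_iInter fun hφ => isClosed_iInter fun hc => ?_
  exact isClosed_eq ((continuous_integral_smul hφ.continuous hc).comp continuous_snd)
    ((continuous_integral_smul (hφ.continuous.mul continuous_id) hc.mul_right).comp continuous_fst)

/-- The form domain with its graph norm, realised as the space of triples `(f, f', x f)` in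
`L²(ℝ)³`; it is the Hilbert space on which the form is bounded. -/
def formSpace : Submodule ℂ (PiLp 2 fun _ : Fin 3 => L2) where
  carrier := {v | HasWeakDeriv (v 0) (v 1) ∧ v 2 =ᵐ[volume] fun x : ℝ => (x : ℂ) * v 0 x}
  zero_mem' := by
    refine ⟨hasWeakDeriv_zero, ?_⟩
    filter_upwards [Lp.coeFn_zero ℂ 2 (volume : Measure ℝ)] with x hx
    rw [PiLp.zero_apply, PiLp.zero_apply, hx, Pi.zero_apply, mul_zero]
  add_mem' := by
    rintro v w ⟨hv, hvx⟩ ⟨hw, hwx⟩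
    refine ⟨hv.add hw, ?_⟩
    filter_upwards [Lp.coeFn_add (v 0) (w 0), Lp.coeFn_add (v 2) (w 2), hvx, hwx]
      with x h0 h2 hv2 hw2
    rw [PiLp.add_apply, PiLp.add_apply, h0, h2, Pi.add_apply, Pi.add_apply, hv2, hw2, mul_add]
  smul_mem' := by
    rintro c v ⟨hv, hvx⟩
    refine ⟨hv.smul c, ?_⟩
    filter_upwards [Lp.coeFn_smul c (v 0), Lp.coeFn_smul c (v 2), hvx] with x h0 h2 hv2
    rw [PiLp.smul_apply, PiLp.smul_apply, h0, h2, Pi.smul_apply, Pi.smul_apply, hv2, smul_eq_mul,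
      smul_eq_mul, mul_left_comm]

namespace formSpace

instance : CompleteSpace formSpace :=
  have hcoord : ∀ i : Fin 3, Continuous fun v : PiLp 2 fun _ : Fin 3 => L2 => v i := fun i =>
    (PiLp.proj (𝕜 := ℂ) 2 (fun _ : Fin 3 => L2) i).continuous
  ((isClosed_hasWeakDeriv.preimage ((hcoord 0).prodMk (hcoord 1))).inter
    (isClosed_ae_eq_ofReal_mul.preimage ((hcoord 0).prodMk (hcoord 2)))).completeSpace_coe

/-- The inclusion `f ↦ f` of the form domain into `L²(ℝ)`. -/
def inclusion : formSpace →L[ℂ] L2 :=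
  (PiLp.proj (𝕜 := ℂ) 2 (fun _ : Fin 3 => L2) 0).comp formSpace.subtypeL

/-- Differentiation `f ↦ f'` as a map from the form domain to `L²(ℝ)`. -/
def derivative : formSpace →L[ℂ] L2 :=
  (PiLp.proj (𝕜 := ℂ) 2 (fun _ : Fin 3 => L2) 1).comp formSpace.subtypeL

/-- Multiplication `f ↦ x f` by the coordinate as a map from the form domain to `L²(ℝ)`. -/
def position : formSpace →L[ℂ] L2 :=
  (PiLp.proj (𝕜 := ℂ) 2 (fun _ : Fin 3 => L2) 2).comp formSpace.subtypeL

theorem norm_sq_eq (v : formSpace) :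
    ‖v‖ ^ 2 = ‖inclusion v‖ ^ 2 + ‖derivative v‖ ^ 2 + ‖position v‖ ^ 2 :=
  (PiLp.norm_sq_eq_of_L2 (fun _ : Fin 3 => L2) (v : PiLp 2 fun _ : Fin 3 => L2)).trans
    (Fin.sum_univ_three _)

theorem position_ae_eq (v : formSpace) :
    position v =ᵐ[volume] fun x : ℝ => (x : ℂ) * inclusion v x := v.2.2

theorem inclusion_mem_formDomain (v : formSpace) : inclusion v ∈ formDomain :=
  ⟨⟨_, v.2.1⟩, (Lp.memLp (position v)).ae_eq (position_ae_eq v)⟩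

theorem weakDeriv_inclusion (v : formSpace) : weakDeriv (inclusion v) = derivative v :=
  HasWeakDeriv.weakDeriv_eq v.2.1

theorem exists_inclusion_eq {f : L2} (hf : f ∈ formDomain) : ∃ v : formSpace, inclusion v = f :=
  ⟨⟨WithLp.toLp 2 ![f, weakDeriv f, hf.2.toLp _],
    hasWeakDeriv_weakDeriv hf.1, hf.2.coeFn_toLp⟩, rfl⟩

theorem norm_contRep_inclusion_sq_le (v : formSpace) (a : ℝ) :
    ‖contRep (inclusion v) a‖ ^ 2 ≤ 2 * (‖inclusion v‖ * ‖derivative v‖) := by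
  rw [← weakDeriv_inclusion]
  exact norm_contRep_sq_le (inclusion_mem_formDomain v).1 a

/-- Evaluation of the continuous representative at `a` as a bounded functional. -/
def evalAt (a : ℝ) : formSpace →L[ℂ] ℂ :=
  LinearMap.mkContinuous
    { toFun := fun v => contRep (inclusion v) a
      map_add' := fun v w => by
        rw [map_add, contRep_add (inclusion_mem_formDomain v).1 (inclusion_mem_formDomain w).1,
          Pi.add_apply]
      map_smul' := fun c v => by
        rw [map_smul, contRep_smul c (inclusion_mem_formDomain v).1, Pi.smul_apply,
          RingHom.id_apply] } 1 fun v => by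
    rw [one_mul]
    refine le_of_sq_le_sq ((norm_contRep_inclusion_sq_le v a).trans ?_) (norm_nonneg v)
    nlinarith [norm_sq_eq v, sq_nonneg (‖inclusion v‖ - ‖derivative v‖),
      sq_nonneg ‖position v‖]

theorem evalAt_apply (a : ℝ) (v : formSpace) : evalAt a v = contRep (inclusion v) a := rfl

end formSpace

open formSpace

/-! ### Coercivity -/

theorem exists_mulOperator {χ : ℝ → ℝ} (hχ : Continuous χ) (hc : HasCompactSupport χ) :
    ∃ K : L2 →L[ℂ] L2, ∀ f, K f =ᵐ[volume] fun x => (χ x : ℂ) * f x := by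
  have hχ' : MemLp (fun x => (χ x : ℂ)) ⊤ volume :=
    (Complex.continuous_ofReal.comp hχ).memLp_of_hasCompactSupport
      (hc.comp_left Complex.ofReal_zero)
  refine ⟨(ContinuousLinearMap.mul ℂ ℂ).holderL volume ⊤ 2 2 (hχ'.toLp _), fun f => ?_⟩
  filter_upwards [(ContinuousLinearMap.mul ℂ ℂ).coeFn_holder (r := 2) (hχ'.toLp _) f,
    hχ'.coeFn_toLp] with x hx hχx
  exact hx.trans (congrArg (· * f x) hχx)

theorem re_inner_eq_integral {χ : ℝ → ℝ} {f k : L2}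
    (hk : k =ᵐ[volume] fun x => (χ x : ℂ) * f x) :
    Integrable (fun x => χ x * ‖f x‖ ^ 2) ∧ (inner ℂ f k).re = ∫ x, χ x * ‖f x‖ ^ 2 := by
  have hinner : (fun x => inner ℂ (f x) (k x)) =ᵐ[volume]
      fun x => ((χ x * ‖f x‖ ^ 2 : ℝ) : ℂ) := by
    filter_upwards [hk] with x hx
    rw [hx, RCLike.inner_apply, mul_assoc, Complex.mul_conj, Complex.normSq_eq_norm_sq,
      Complex.ofReal_mul]
  refine ⟨?_, ?_⟩
  · exact ((L2.integrable_inner f k).congr hinner).re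
  · rw [L2.inner_def, integral_congr_ae hinner, integral_complex_ofReal, Complex.ofReal_re]

theorem integrable_norm_sq (f : L2) : Integrable fun x => ‖f x‖ ^ 2 :=
  (Lp.memLp f).integrable_norm_pow two_ne_zero

theorem norm_sq_eq_integral (f : L2) : ‖f‖ ^ 2 = ∫ x, ‖f x‖ ^ 2 := by
  have h := (re_inner_eq_integral (χ := 1) (f := f) (k := f) (by simp)).2
  simp only [Pi.one_apply, one_mul] at h
  rw [← h]
  exact (inner_self_eq_norm_sq (𝕜 := ℂ) f).symm

theorem mul_norm_inclusion_sq_le {χ : ℝ → ℝ} {N : ℝ} (hχ : ∀ x, N ≤ x ^ 2 / 8 + χ x)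
    (v : formSpace) {k : L2} (hk : k =ᵐ[volume] fun x => (χ x : ℂ) * inclusion v x) :
    N * ‖inclusion v‖ ^ 2 ≤ 1 / 8 * ‖position v‖ ^ 2 + (inner ℂ (inclusion v) k).re := by
  have hpos := (integrable_norm_sq (position v)).const_mul (1 / 8)
  obtain ⟨hweight, hre⟩ := re_inner_eq_integral hk
  rw [hre, norm_sq_eq_integral, norm_sq_eq_integral, ← integral_const_mul, ← integral_const_mul,
    ← integral_add hpos hweight]
  refine integral_mono_ae ((integrable_norm_sq _).const_mul N) (hpos.add hweight) ?_
  filter_upwards [position_ae_eq v] with x hx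
  rw [hx, norm_mul, Complex.norm_real, mul_pow, Real.norm_eq_abs, sq_abs,
    ← mul_assoc, ← add_mul, one_div_mul_eq_div]
  exact mul_le_mul_of_nonneg_right (hχ x) (sq_nonneg _)

/-- The part of `N` that is not dominated by the weight `x² / 8`; adding it to the operator makes
the form coercive. -/
def cutoff (N x : ℝ) : ℝ := max 0 (N - x ^ 2 / 8)

theorem continuous_cutoff (N : ℝ) : Continuous (cutoff N) := by
  unfold cutoff
  fun_prop

theorem hasCompactSupport_cutoff (N : ℝ) : HasCompactSupport (cutoff N) := by
  refine .intro (isCompact_closedBall 0 (8 * |N| + 1)) fun x hx => max_eq_left ?_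
  rw [mem_closedBall_zero_iff, Real.norm_eq_abs, not_le] at hx
  nlinarith [sq_abs x, le_abs_self N, abs_nonneg N]

theorem le_add_cutoff (N x : ℝ) : N ≤ x ^ 2 / 8 + cutoff N x := by
  linarith [le_max_right 0 (N - x ^ 2 / 8), cutoff.eq_def N x]

/-- The bounded operator on the form space which represents the form of `L - ν + K`. -/
def formOperator (z : ℂ) (b : ℝ) (ν : ℂ) (K : L2 →L[ℂ] L2) : formSpace →L[ℂ] formSpace :=
  derivative.adjoint ∘L derivative + (1 / 4 : ℂ) • (position.adjoint ∘L position)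
    - (1 / 2 + ν) • (inclusion.adjoint ∘L inclusion) + inclusion.adjoint ∘L (K ∘L inclusion)
    + z • ((evalAt b).adjoint ∘L evalAt b - (evalAt (-b)).adjoint ∘L evalAt (-b))

theorem inner_formOperator_eq_sum (z : ℂ) (b : ℝ) (ν : ℂ) (K : L2 →L[ℂ] L2) (v w : formSpace) :
    inner ℂ w (formOperator z b ν K v) =
      inner ℂ (derivative w) (derivative v) + 1 / 4 * inner ℂ (position w) (position v)
        - (1 / 2 + ν) * inner ℂ (inclusion w) (inclusion v)
        + inner ℂ (inclusion w) (K (inclusion v))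
        + z * (evalAt b v * conj (evalAt b w) - evalAt (-b) v * conj (evalAt (-b) w)) := by
  have hsmul : ∀ (c : ℂ) (u : formSpace), inner ℂ w (c • u) = c * inner ℂ w u :=
    fun c u => inner_smul_right w u c
  simp only [formOperator, add_apply, sub_apply, smul_apply, ContinuousLinearMap.comp_apply,
    inner_add_right, inner_sub_right, hsmul, ContinuousLinearMap.adjoint_inner_right,
    RCLike.inner_apply]

theorem inner_formOperator (z : ℂ) (b : ℝ) (ν : ℂ) (K : L2 →L[ℂ] L2) (v w : formSpace) :
    inner ℂ w (formOperator z b ν K v) = form z b (inclusion v) (inclusion w)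
      - ν * inner ℂ (inclusion w) (inclusion v) + inner ℂ (inclusion w) (K (inclusion v)) := by
  have hpos : inner ℂ (position w) (position v) =
      ∫ x : ℝ, ((x : ℂ) * inclusion v x) * conj ((x : ℂ) * inclusion w x) := by
    rw [L2.inner_def]
    refine integral_congr_ae ?_
    filter_upwards [position_ae_eq v, position_ae_eq w] with x hv hw
    rw [hv, hw, RCLike.inner_apply]
  rw [inner_formOperator_eq_sum, form, weakDeriv_inclusion, weakDeriv_inclusion, hpos]
  simp only [evalAt_apply]
  ring

theorem re_inner_formOperator_self (z : ℂ) (b : ℝ) (ν : ℂ) (K : L2 →L[ℂ] L2) (v : formSpace) :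
    (inner ℂ v (formOperator z b ν K v)).re =
      ‖derivative v‖ ^ 2 + 1 / 4 * ‖position v‖ ^ 2 - (1 / 2 + ν.re) * ‖inclusion v‖ ^ 2
        + (inner ℂ (inclusion v) (K (inclusion v))).re
        + z.re * (‖evalAt b v‖ ^ 2 - ‖evalAt (-b) v‖ ^ 2) := by
  have hself : ∀ f : L2, inner ℂ f f = ((‖f‖ ^ 2 : ℝ) : ℂ) := fun f => by
    rw [inner_self_eq_norm_sq_to_K, Complex.ofReal_pow]
    rfl
  have hnormSq : ∀ w : ℂ, w * conj w = ((‖w‖ ^ 2 : ℝ) : ℂ) := fun w => by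
    rw [Complex.mul_conj, Complex.normSq_eq_norm_sq]
  rw [inner_formOperator_eq_sum, hself, hself, hself, hnormSq, hnormSq, ← Complex.ofReal_sub]
  simp only [Complex.add_re, Complex.sub_re, Complex.re_mul_ofReal, Complex.ofReal_re]
  norm_num

theorem neg_le_re_mul_evalAt_sub (z : ℂ) (b : ℝ) (v : formSpace) :
    -(1 / 2 * ‖derivative v‖ ^ 2 + 2 * ‖z‖ ^ 2 * ‖inclusion v‖ ^ 2) ≤
      z.re * (‖evalAt b v‖ ^ 2 - ‖evalAt (-b) v‖ ^ 2) := by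
  have hb := norm_contRep_inclusion_sq_le v b
  have hb' := norm_contRep_inclusion_sq_le v (-b)
  rw [← evalAt_apply] at hb hb'
  have hdiff : |‖evalAt b v‖ ^ 2 - ‖evalAt (-b) v‖ ^ 2| ≤
      2 * (‖inclusion v‖ * ‖derivative v‖) := by
    rw [abs_le]
    constructor <;> nlinarith [sq_nonneg ‖evalAt b v‖, sq_nonneg ‖evalAt (-b) v‖]
  refine neg_le_of_abs_le ?_
  calc |z.re * (‖evalAt b v‖ ^ 2 - ‖evalAt (-b) v‖ ^ 2)|
      ≤ ‖z‖ * (2 * (‖inclusion v‖ * ‖derivative v‖)) := by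
        rw [abs_mul]
        exact mul_le_mul (Complex.abs_re_le_norm z) hdiff (abs_nonneg _) (norm_nonneg z)
    _ ≤ 1 / 2 * ‖derivative v‖ ^ 2 + 2 * ‖z‖ ^ 2 * ‖inclusion v‖ ^ 2 := by
        nlinarith [sq_nonneg (‖derivative v‖ - 2 * (‖z‖ * ‖inclusion v‖)),
          sq_nonneg (‖z‖ * ‖inclusion v‖)]

theorem norm_sq_le_re_inner_formOperator {z : ℂ} {b : ℝ} {ν : ℂ} {χ : ℝ → ℝ} {K : L2 →L[ℂ] L2}
    (hχ : ∀ x, 1 + ν.re + 2 * ‖z‖ ^ 2 ≤ x ^ 2 / 8 + χ x)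
    (hK : ∀ f, K f =ᵐ[volume] fun x => (χ x : ℂ) * f x) (v : formSpace) :
    ‖v‖ ^ 2 * (1 / 8) ≤ (inner ℂ v (formOperator z b ν K v)).re := by
  rw [re_inner_formOperator_self, norm_sq_eq]
  have hweight := mul_norm_inclusion_sq_le hχ v (hK (inclusion v))
  have hdelta := neg_le_re_mul_evalAt_sub z b v
  nlinarith [sq_nonneg ‖inclusion v‖, sq_nonneg ‖derivative v‖, sq_nonneg ‖position v‖]

theorem exists_isUnit_formOperator (z : ℂ) (b : ℝ) (ν : ℂ) :
    ∃ χ : ℝ → ℝ, HasCompactSupport χ ∧ ∃ K : L2 →L[ℂ] L2,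
      (∀ f, K f =ᵐ[volume] fun x => (χ x : ℂ) * f x) ∧ IsUnit (formOperator z b ν K) := by
  let N := 1 + ν.re + 2 * ‖z‖ ^ 2
  obtain ⟨K, hK⟩ := exists_mulOperator (continuous_cutoff N) (hasCompactSupport_cutoff N)
  refine ⟨cutoff N, hasCompactSupport_cutoff N, K, hK,
    ContinuousLinearMap.isUnit_of_forall_le_norm_inner_map (c := 1 / 8) _ (by norm_num)
      fun v => ?_⟩
  rw [norm_inner_symm]
  have hcoercive := norm_sq_le_re_inner_formOperator (b := b) (le_add_cutoff N) hK v
  exact (by simpa using hcoercive :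
    ‖v‖ ^ 2 * ((1 / 8 : NNReal) : ℝ) ≤ _).trans (Complex.re_le_norm _)

/-! ### The resolvent of a compactly supported perturbation -/

/-- `S` solves `(L - ν + K) f = h`, and the solution is unique. -/
structure IsPerturbedResolvent (z : ℂ) (b : ℝ) (ν : ℂ) (K S : L2 →L[ℂ] L2) : Prop where
  mem_operatorGraph : ∀ h, (S h, h + ν • S h - K (S h)) ∈ operatorGraph z b
  eq_apply : ∀ {f h}, (f, h) ∈ operatorGraph z b → f = S (h - ν • f + K f)

theorem IsPerturbedResolvent.of_isUnit {z : ℂ} {b : ℝ} {ν : ℂ} {K : L2 →L[ℂ] L2}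
    (hK : IsUnit (formOperator z b ν K)) :
    ∃ S, IsPerturbedResolvent z b ν K S := by
  obtain ⟨T, hT⟩ := hK
  have hright : ∀ v, T.1 (T.2 v) = v := DFunLike.congr_fun T.val_inv
  have hleft : ∀ v, T.2 (T.1 v) = v := DFunLike.congr_fun T.inv_val
  refine ⟨inclusion ∘L T.2 ∘L inclusion.adjoint, fun h => ⟨inclusion_mem_formDomain _, ?_⟩, ?_⟩
  · intro g hg
    obtain ⟨w, rfl⟩ := exists_inclusion_eq hg
    have hform := inner_formOperator z b ν K (T.2 (inclusion.adjoint h)) w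
    rw [← hT, hright, ContinuousLinearMap.adjoint_inner_right] at hform
    simp only [ContinuousLinearMap.comp_apply, inner_add_right, inner_sub_right, inner_smul_right]
    rw [hform]
    ring
  · intro f h hf
    obtain ⟨v, rfl⟩ := exists_inclusion_eq hf.1
    have hv : T.1 v = inclusion.adjoint (h - ν • inclusion v + K (inclusion v)) := by
      refine ext_inner_left ℂ fun w => ?_
      rw [hT, inner_formOperator, ContinuousLinearMap.adjoint_inner_right,
        hf.2 _ (inclusion_mem_formDomain w)]
      simp only [inner_add_right, inner_sub_right, inner_smul_right]
    rw [ContinuousLinearMap.comp_apply, ContinuousLinearMap.comp_apply, ← hv, hleft]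

theorem exists_isPerturbedResolvent (z : ℂ) (b : ℝ) (ν : ℂ) :
    ∃ χ : ℝ → ℝ, HasCompactSupport χ ∧ ∃ K S : L2 →L[ℂ] L2,
      (∀ f, K f =ᵐ[volume] fun x => (χ x : ℂ) * f x) ∧ IsPerturbedResolvent z b ν K S := by
  obtain ⟨χ, hχ, K, hK, hunit⟩ := exists_isUnit_formOperator z b ν
  obtain ⟨S, hS⟩ := IsPerturbedResolvent.of_isUnit hunit
  exact ⟨χ, hχ, K, S, hK, hS⟩

/-! ### Solutions of the differential equation -/

/-- `u` is a solution of `-u'' + (x²/4 - 1/2) u = ν u + h` with derivative `v`, for a source `h`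
that need only be locally integrable. -/
structure IsSolution (ν : ℂ) (h u v : ℝ → ℂ) : Prop where
  isPrimitive : IsPrimitive u v
  isPrimitive_deriv : IsPrimitive v fun x => (potential x - ν) * u x - h x

/-- The Wronskian `v w - u w'` of `u` and `w`, where `v` and `w'` are the derivatives. The second
function is one of the special functions of a complex variable, restricted to the real line. -/
def wronskian (u v : ℝ → ℂ) (w w' : ℂ → ℂ) (x : ℝ) : ℂ := v x * w x - u x * w' x

theorem IsPrimitive.comp_neg {G g : ℝ → ℂ} (hG : IsPrimitive G g) :
    IsPrimitive (fun x => G (-x)) fun x => -g (-x) := by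
  refine ⟨?_, fun x y => ?_⟩
  · refine ((locallyIntegrable_map_homeomorph (Homeomorph.neg ℝ) (μ := volume)).1 ?_).neg
    simpa only [Homeomorph.coe_neg, Measure.map_neg_eq_self] using hG.locallyIntegrable
  · rw [intervalIntegral.integral_neg, intervalIntegral.integral_comp_neg, hG.integral_eq, neg_sub]

namespace IsSolution

variable {ν : ℂ} {h k u v w w' : ℝ → ℂ}

theorem add (hu : IsSolution ν h u v) (hw : IsSolution ν k w w') :
    IsSolution ν (h + k) (u + w) (v + w') := by
  refine ⟨hu.isPrimitive.add hw.isPrimitive, ?_⟩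
  convert hu.isPrimitive_deriv.add hw.isPrimitive_deriv using 1
  ext x
  simp only [Pi.add_apply]
  ring

theorem add_homogeneous (hu : IsSolution ν h u v) (hw : IsSolution ν 0 w w') :
    IsSolution ν h (u + w) (v + w') := by
  simpa only [add_zero] using hu.add hw

theorem const_mul (c : ℂ) (hu : IsSolution ν 0 u v) :
    IsSolution ν 0 (fun x => c * u x) fun x => c * v x := by
  refine ⟨hu.isPrimitive.const_mul c, ?_⟩
  convert hu.isPrimitive_deriv.const_mul c using 1
  ext x
  simp only [Pi.zero_apply]
  ring

theorem comp_neg (hu : IsSolution ν h u v) :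
    IsSolution ν (fun x => h (-x)) (fun x => u (-x)) fun x => -v (-x) := by
  refine ⟨hu.isPrimitive.comp_neg, ?_⟩
  convert hu.isPrimitive_deriv.comp_neg.neg using 1
  · rfl
  ext x
  simp only [potential, Pi.neg_apply, Complex.ofReal_neg, neg_sq, neg_neg]

theorem congr_ae (hu : IsSolution ν h u v) (hhk : h =ᵐ[volume] k) : IsSolution ν k u v :=
  ⟨hu.isPrimitive, hu.isPrimitive_deriv.congr_ae <| hhk.mono fun x hx => by simp only [hx]⟩

theorem of_hasDerivAt (hu : ∀ x, HasDerivAt u (v x) x)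
    (hv : ∀ x : ℝ, HasDerivAt v ((potential x - ν) * u x) x) : IsSolution ν 0 u v := by
  have hu_cont : Continuous u := continuous_iff_continuousAt.2 fun x => (hu x).continuousAt
  refine ⟨.of_hasDerivAt hu (continuous_iff_continuousAt.2 fun x => (hv x).continuousAt), ?_⟩
  simpa only [Pi.zero_apply, sub_zero] using
    IsPrimitive.of_hasDerivAt hv ((continuous_potential.sub continuous_const).mul hu_cont)

end IsSolution

theorem isSolution_yEven (ν : ℂ) :
    IsSolution ν 0 (fun x : ℝ => yEven ν x) fun x : ℝ => yEvenDeriv ν x :=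
  .of_hasDerivAt (fun x => (hasDerivAt_yEven ν x).comp_ofReal)
    fun x => (hasDerivAt_yEvenDeriv ν x).comp_ofReal

theorem isSolution_yOdd (ν : ℂ) :
    IsSolution ν 0 (fun x : ℝ => yOdd ν x) fun x : ℝ => yOddDeriv ν x :=
  .of_hasDerivAt (fun x => (hasDerivAt_yOdd ν x).comp_ofReal)
    fun x => (hasDerivAt_yOddDeriv ν x).comp_ofReal

theorem isSolution_linearCombination (ν α β : ℂ) :
    IsSolution ν 0 (fun x : ℝ => α * yEven ν x + β * yOdd ν x)
      fun x : ℝ => α * yEvenDeriv ν x + β * yOddDeriv ν x :=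
  ((isSolution_yEven ν).const_mul α).add_homogeneous ((isSolution_yOdd ν).const_mul β)

theorem isSolution_parabolicD (ν : ℂ) :
    IsSolution ν 0 (fun x : ℝ => parabolicD ν x) fun x : ℝ => parabolicDDeriv ν x := by
  convert isSolution_linearCombination ν (evenCoeff ν) (-oddCoeff ν) using 2 <;>
    simp only [parabolicD_eq, parabolicDDeriv, neg_mul, sub_eq_add_neg]

theorem eq_add_wronskian (ν : ℂ) (u v : ℝ → ℂ) (x : ℝ) :
    u x = -wronskian u v (yOdd ν) (yOddDeriv ν) x * yEven ν x +
      wronskian u v (yEven ν) (yEvenDeriv ν) x * yOdd ν x := by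
  rw [wronskian, wronskian]
  linear_combination -u x * wronskian_yEven_yOdd ν x

theorem eq_deriv_add_wronskian (ν : ℂ) (u v : ℝ → ℂ) (x : ℝ) :
    v x = -wronskian u v (yOdd ν) (yOddDeriv ν) x * yEvenDeriv ν x +
      wronskian u v (yEven ν) (yEvenDeriv ν) x * yOddDeriv ν x := by
  rw [wronskian, wronskian]
  linear_combination -v x * wronskian_yEven_yOdd ν x

namespace IsSolution

variable {ν : ℂ} {h u v : ℝ → ℂ} {w w' : ℂ → ℂ} {r : ℝ}

/-- Lagrange's identity. -/
theorem isPrimitive_wronskian (hu : IsSolution ν h u v)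
    (hw : IsSolution ν 0 (fun x : ℝ => w x) fun x : ℝ => w' x) :
    IsPrimitive (wronskian u v w w') fun x => -(h x * w x) := by
  convert (hu.isPrimitive_deriv.mul hw.isPrimitive).sub
    (hu.isPrimitive.mul hw.isPrimitive_deriv) using 1
  · rfl
  ext x
  simp only [Pi.mul_apply, Pi.sub_apply, Pi.add_apply, Pi.zero_apply]
  ring

theorem wronskian_eq {x : ℝ} (hu : IsSolution ν h u v)
    (hw : IsSolution ν 0 (fun x : ℝ => w x) fun x : ℝ => w' x)
    (hh : ∀ᵐ t, r ≤ t → h t = 0) (hx : r ≤ x) :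
    wronskian u v w w' x = wronskian u v w w' r := by
  rw [(hu.isPrimitive_wronskian hw).eq_add_integral r x, add_eq_left]
  refine intervalIntegral.integral_zero_ae ?_
  filter_upwards [hh] with t ht hmem
  rw [Set.uIoc_of_le hx] at hmem
  rw [ht hmem.1.le, zero_mul, neg_zero]

theorem exists_eq_linearCombination_of_le (hu : IsSolution ν h u v)
    (hh : ∀ᵐ t, r ≤ t → h t = 0) :
    ∃ α β : ℂ, ∀ x : ℝ, r ≤ x → u x = α * yEven ν x + β * yOdd ν x ∧
      v x = α * yEvenDeriv ν x + β * yOddDeriv ν x := by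
  refine ⟨-wronskian u v (yOdd ν) (yOddDeriv ν) r, wronskian u v (yEven ν) (yEvenDeriv ν) r,
    fun x hx => ?_⟩
  rw [← hu.wronskian_eq (isSolution_yOdd ν) hh hx, ← hu.wronskian_eq (isSolution_yEven ν) hh hx]
  exact ⟨eq_add_wronskian ν u v x, eq_deriv_add_wronskian ν u v x⟩

theorem exists_eq_linearCombination (hu : IsSolution ν 0 u v) :
    ∃ α β : ℂ, u = (fun x : ℝ => α * yEven ν x + β * yOdd ν x) ∧
      v = fun x : ℝ => α * yEvenDeriv ν x + β * yOddDeriv ν x := by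
  have hconst {w w' : ℂ → ℂ} (hw : IsSolution ν 0 (fun x : ℝ => w x) fun x : ℝ => w' x) (x : ℝ) :
      wronskian u v w w' x = wronskian u v w w' 0 :=
    have hzero (r : ℝ) : ∀ᵐ t, r ≤ t → (0 : ℝ → ℂ) t = 0 := .of_forall fun _ _ => rfl
    (hu.wronskian_eq hw (hzero _) (min_le_left x 0)).trans
      (hu.wronskian_eq hw (hzero _) (min_le_right x 0)).symm
  refine ⟨-wronskian u v (yOdd ν) (yOddDeriv ν) 0, wronskian u v (yEven ν) (yEvenDeriv ν) 0,
    funext fun x => ?_, funext fun x => ?_⟩ <;>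
  rw [← hconst (isSolution_yOdd ν) x, ← hconst (isSolution_yEven ν) x]
  exacts [eq_add_wronskian ν u v x, eq_deriv_add_wronskian ν u v x]

end IsSolution

theorem eq_zero_of_linearCombination_eq_zero {ν α β : ℂ}
    (h : (fun x : ℝ => α * yEven ν x + β * yOdd ν x) = 0) : α = 0 ∧ β = 0 := by
  have hderiv : α * yEvenDeriv ν 0 + β * yOddDeriv ν 0 = 0 := by
    refine HasDerivAt.unique (x := (0 : ℝ)) ?_ (hasDerivAt_const (0 : ℝ) (0 : ℂ))
    have := ((hasDerivAt_yEven ν ((0 : ℝ) : ℂ)).comp_ofReal.const_mul α).add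
      ((hasDerivAt_yOdd ν ((0 : ℝ) : ℂ)).comp_ofReal.const_mul β)
    rw [Complex.ofReal_zero] at this
    exact this.congr_of_eventuallyEq (.of_forall fun x => (congrFun h x).symm)
  have hvalue := congrFun h 0
  simp only [Complex.ofReal_zero, Pi.zero_apply] at hvalue
  have hW := wronskian_yEven_yOdd ν 0
  constructor
  · linear_combination yOddDeriv ν 0 * hvalue - yOdd ν 0 * hderiv - α * hW
  · linear_combination yEven ν 0 * hderiv - yEvenDeriv ν 0 * hvalue - β * hW

/-- Variation of constants. -/
theorem exists_isSolution (ν : ℂ) {h : ℝ → ℂ} (hh : LocallyIntegrable h) :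
    ∃ u v, IsSolution ν h u v := by
  have hE := isSolution_yEven ν
  have hO := isSolution_yOdd ν
  let mE : ℝ → ℂ := fun x => ∫ t in (0 : ℝ)..x, yEven ν t * h t
  let mO : ℝ → ℂ := fun x => ∫ t in (0 : ℝ)..x, yOdd ν t * h t
  have hmE : IsPrimitive mE fun x => yEven ν x * h x :=
    .integral (hh.continuous_mul hE.isPrimitive.continuous) 0
  have hmO : IsPrimitive mO fun x => yOdd ν x * h x :=
    .integral (hh.continuous_mul hO.isPrimitive.continuous) 0
  refine ⟨mO * (fun x : ℝ => yEven ν x) - mE * fun x : ℝ => yOdd ν x,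
    mO * (fun x : ℝ => yEvenDeriv ν x) - mE * fun x : ℝ => yOddDeriv ν x, ?_, ?_⟩
  · convert (hmO.mul hE.isPrimitive).sub (hmE.mul hO.isPrimitive) using 1
    ext x
    simp only [Pi.add_apply, Pi.sub_apply, Pi.mul_apply]
    ring
  · convert (hmO.mul hE.isPrimitive_deriv).sub (hmE.mul hO.isPrimitive_deriv) using 1
    ext x
    simp only [Pi.add_apply, Pi.sub_apply, Pi.mul_apply, Pi.zero_apply]
    linear_combination h x * wronskian_yEven_yOdd ν x

/-! ### Behaviour at infinity -/

theorem wronskian_yEven_parabolicD (ν : ℂ) (x : ℝ) :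
    wronskian (fun x : ℝ => yEven ν x) (fun x : ℝ => yEvenDeriv ν x)
      (parabolicD ν) (parabolicDDeriv ν) x = oddCoeff ν := by
  simp only [wronskian, parabolicD_eq, parabolicDDeriv]
  linear_combination oddCoeff ν * wronskian_yEven_yOdd ν x

theorem wronskian_yOdd_parabolicD (ν : ℂ) (x : ℝ) :
    wronskian (fun x : ℝ => yOdd ν x) (fun x : ℝ => yOddDeriv ν x)
      (parabolicD ν) (parabolicDDeriv ν) x = evenCoeff ν := by
  simp only [wronskian, parabolicD_eq, parabolicDDeriv]
  linear_combination evenCoeff ν * wronskian_yEven_yOdd ν x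

theorem exists_eq_mul_of_mul_add_mul_eq_zero {A B α β : ℂ} (hAB : A ≠ 0 ∨ B ≠ 0)
    (h : B * α + A * β = 0) : ∃ κ, α = κ * A ∧ β = -(κ * B) := by
  rcases hAB with hA | hB
  · refine ⟨α / A, by field_simp, ?_⟩
    field_simp
    linear_combination h
  · refine ⟨-β / B, ?_, by field_simp⟩
    field_simp
    linear_combination h

/-- Beyond `r` such a solution is a multiple of `D_ν`. -/
theorem IsSolution.rapidDecay {ν : ℂ} {h u v : ℝ → ℂ} {r : ℝ} (hu : IsSolution ν h u v)
    (hh : ∀ᵐ t, r ≤ t → h t = 0)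
    (hW : wronskian u v (parabolicD ν) (parabolicDDeriv ν) r = 0) :
    RapidDecay u ∧ RapidDecay v := by
  obtain ⟨α, β, hαβ⟩ := hu.exists_eq_linearCombination_of_le hh
  obtain ⟨κ, rfl, rfl⟩ := exists_eq_mul_of_mul_add_mul_eq_zero (α := α) (β := β)
    (evenCoeff_ne_zero_or_oddCoeff_ne_zero ν) (by
      rw [← hW, ← wronskian_yEven_parabolicD ν r, ← wronskian_yOdd_parabolicD ν r]
      simp only [wronskian, (hαβ r le_rfl).1, (hαβ r le_rfl).2]
      ring)
  refine ⟨((rapidDecay_parabolicD ν).const_mul κ).congr' ?_,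
    ((rapidDecay_parabolicDDeriv ν).const_mul κ).congr' ?_⟩
  · filter_upwards [Filter.eventually_ge_atTop r] with x hx
    rw [(hαβ x hx).1, parabolicD_eq]
    ring
  · filter_upwards [Filter.eventually_ge_atTop r] with x hx
    rw [(hαβ x hx).2, parabolicDDeriv]
    ring

theorem IsSolution.wronskian_parabolicD_eq_zero {ν : ℂ} {h u v : ℝ → ℂ} {r : ℝ}
    (hu : IsSolution ν h u v) (hh : ∀ᵐ t, r ≤ t → h t = 0)
    (hu_mem : MemLp u 2 (volume.restrict (Set.Ioi r)))
    (hv_mem : MemLp v 2 (volume.restrict (Set.Ioi r))) :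
    wronskian u v (parabolicD ν) (parabolicDDeriv ν) r = 0 := by
  have hD := isSolution_parabolicD ν
  have hint : IntegrableOn (wronskian u v (parabolicD ν) (parabolicDDeriv ν)) (Set.Ioi r) :=
    (hv_mem.integrable_mul
        ((rapidDecay_parabolicD ν).memLp_Ioi hD.isPrimitive.continuous r)).sub
      (hu_mem.integrable_mul
        ((rapidDecay_parabolicDDeriv ν).memLp_Ioi hD.isPrimitive_deriv.continuous r))
  have hconst := hint.congr_fun (fun x hx => hu.wronskian_eq hD hh (le_of_lt hx)) measurableSet_Ioi
  rw [integrableOn_const_iff] at hconst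
  exact enorm_eq_zero.1 (hconst.resolve_right (by simp))

/-! ### Solutions with point interactions -/

theorem add_glue (b : ℝ) (u fl fm fr : ℝ → ℂ) :
    u + glue b fl fm fr = glue b (u + fl) (u + fm) (u + fr) := by
  ext x
  simp only [glue, Set.piecewise, Pi.add_apply]
  split_ifs <;> rfl

theorem mul_glue (b : ℝ) (u fl fm fr : ℝ → ℂ) :
    u * glue b fl fm fr = glue b (u * fl) (u * fm) (u * fr) := by
  ext x
  simp only [glue, Set.piecewise, Pi.mul_apply]
  split_ifs <;> rfl

theorem memLp_Iic_of_comp_neg {g : ℝ → ℂ} {b : ℝ}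
    (hg : MemLp (fun x => g (-x)) 2 (volume.restrict (Set.Ioi b))) :
    MemLp g 2 (volume.restrict (Set.Iic (-b))) := by
  have hneg : MeasurePreserving (Neg.neg : ℝ → ℝ) (volume.restrict (Set.Iio (-b)))
      (volume.restrict (Set.Ioi b)) := by
    simpa only [Set.neg_preimage, Set.neg_Ioi] using
      (Measure.measurePreserving_neg (volume : Measure ℝ)).restrict_preimage
        (s := Set.Ioi b) measurableSet_Ioi
  rw [← restrict_Iio_eq_restrict_Iic]
  simpa only [Function.comp_def, neg_neg] using hg.comp_measurePreserving hneg

theorem memLp_glue (b : ℝ) {fl fm fr : ℝ → ℂ} (hl : Continuous fl) (hm : Continuous fm)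
    (hr : Continuous fr) (hl' : RapidDecay fun x => fl (-x)) (hr' : RapidDecay fr) :
    MemLp (glue b fl fm fr) 2 := by
  refine .piecewise measurableSet_Iic
    (memLp_Iic_of_comp_neg (hl'.memLp_Ioi (hl.comp continuous_neg) b)) ?_
  refine .piecewise measurableSet_Iic ?_ ?_
  · rw [Measure.restrict_restrict measurableSet_Iic, Set.compl_Iic, Set.inter_comm,
      Set.Ioi_inter_Iic]
    exact (memLp_two_iff_integrable_sq_norm hm.aestronglyMeasurable).2
      (hm.norm.pow 2).integrableOn_Ioc
  · refine (hr'.memLp_Ioi hr b).mono_measure ?_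
    rw [← Set.compl_Iic]
    exact Measure.restrict_mono_measure Measure.restrict_le_self _

/-- The solution of the homogeneous equation with `y(a) = 0` and `y'(a) = 1`. -/
def fundamentalSolution (ν : ℂ) (a x : ℝ) : ℂ := yEven ν a * yOdd ν x - yOdd ν a * yEven ν x

/-- The derivative of `fundamentalSolution ν a`. -/
def fundamentalSolutionDeriv (ν : ℂ) (a x : ℝ) : ℂ :=
  yEven ν a * yOddDeriv ν x - yOdd ν a * yEvenDeriv ν x

theorem isSolution_fundamentalSolution (ν : ℂ) (a : ℝ) :
    IsSolution ν 0 (fundamentalSolution ν a) (fundamentalSolutionDeriv ν a) := by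
  convert isSolution_linearCombination ν (-yOdd ν a) (yEven ν a) using 1 <;> ext x <;>
    simp only [fundamentalSolution, fundamentalSolutionDeriv] <;> ring

theorem fundamentalSolution_self (ν : ℂ) (a : ℝ) : fundamentalSolution ν a a = 0 := by
  rw [fundamentalSolution, mul_comm, sub_self]

theorem fundamentalSolutionDeriv_self (ν : ℂ) (a : ℝ) : fundamentalSolutionDeriv ν a a = 1 := by
  rw [fundamentalSolutionDeriv, mul_comm (yOdd ν a), wronskian_yEven_yOdd]

theorem fundamentalSolution_neg (ν : ℂ) (a x : ℝ) :
    fundamentalSolution ν (-a) (-x) = -fundamentalSolution ν a x := by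
  simp only [fundamentalSolution, Complex.ofReal_neg, yEven_neg, yOdd_neg]
  ring

theorem fundamentalSolutionDeriv_neg (ν : ℂ) (a x : ℝ) :
    fundamentalSolutionDeriv ν (-a) (-x) = fundamentalSolutionDeriv ν a x := by
  simp only [fundamentalSolutionDeriv, Complex.ofReal_neg, yEven_neg, yOdd_neg, yEvenDeriv_neg,
    yOddDeriv_neg]
  ring

theorem wronskian_fundamentalSolution (ν : ℂ) (a : ℝ) (w w' : ℂ → ℂ) :
    wronskian (fundamentalSolution ν a) (fundamentalSolutionDeriv ν a) w w' a = w a := by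
  rw [wronskian, fundamentalSolution_self, fundamentalSolutionDeriv_self, one_mul, zero_mul,
    sub_zero]

/-- The function that solves the homogeneous equation away from `±b`, vanishes on `(-b, b]`, and
whose derivative jumps by `-cl` at `-b` and by `cr` at `b`. -/
def impulseResponse (ν : ℂ) (b : ℝ) (cl cr : ℂ) : ℝ → ℂ :=
  glue b (fun x => cl * fundamentalSolution ν (-b) x) 0 fun x => cr * fundamentalSolution ν b x

/-- The derivative of `impulseResponse ν b cl cr`. -/
def impulseResponseDeriv (ν : ℂ) (b : ℝ) (cl cr : ℂ) : ℝ → ℂ :=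
  glue b (fun x => cl * fundamentalSolutionDeriv ν (-b) x) 0
    fun x => cr * fundamentalSolutionDeriv ν b x

theorem isPrimitive_impulseResponse (ν : ℂ) {b : ℝ} (hb : 0 ≤ b) (cl cr : ℂ) :
    IsPrimitive (impulseResponse ν b cl cr) (impulseResponseDeriv ν b cl cr) :=
  .glue hb ((isSolution_fundamentalSolution ν (-b)).const_mul cl).isPrimitive
    (.zero_right 0) ((isSolution_fundamentalSolution ν b).const_mul cr).isPrimitive
    (by simp [fundamentalSolution_self]) (by simp [fundamentalSolution_self])

theorem isPrimitive_impulseResponseDeriv_sub_jump (ν : ℂ) {b : ℝ} (hb : 0 ≤ b) (cl cr : ℂ) :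
    IsPrimitive (impulseResponseDeriv ν b cl cr - jump b cl cr)
      fun x => (potential x - ν) * impulseResponse ν b cl cr x := by
  have hl := ((isSolution_fundamentalSolution ν (-b)).const_mul cl).isPrimitive_deriv
  have hr := ((isSolution_fundamentalSolution ν b).const_mul cr).isPrimitive_deriv
  convert IsPrimitive.glue (b := b) hb (hl.sub (.zero_right cl)) (.zero_right 0)
    (hr.sub (.zero_right cr)) (by simp [fundamentalSolutionDeriv_self])
    (by simp [fundamentalSolutionDeriv_self]) using 1 <;> ext x <;>
    simp only [impulseResponse, impulseResponseDeriv, jump, glue, Set.piecewise, Pi.sub_apply,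
      Pi.zero_apply] <;> split_ifs <;> ring

theorem impulseResponse_left (ν : ℂ) (b : ℝ) (cl cr : ℂ) :
    impulseResponse ν b cl cr (-b) = 0 := by
  rw [impulseResponse, glue_of_le _ _ _ le_rfl, fundamentalSolution_self, mul_zero]

theorem impulseResponse_right (ν : ℂ) {b : ℝ} (hb : 0 < b) (cl cr : ℂ) :
    impulseResponse ν b cl cr b = 0 := by
  rw [impulseResponse, glue_of_mem_Ioc _ _ _ ⟨by linarith, le_rfl⟩, Pi.zero_apply]

section PointInteraction

variable {z ν : ℂ} {b r : ℝ} {f H : L2} {u v : ℝ → ℂ}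

theorem exists_isSolution_of_mem_operatorGraph (hb : 0 < b)
    (hf : (f, H + ν • f) ∈ operatorGraph z b) :
    ∃ u v, IsSolution ν H u v ∧
      contRep f = u + impulseResponse ν b (z * u (-b)) (z * u b) ∧
      weakDeriv f =ᵐ[volume] v + impulseResponseDeriv ν b (z * u (-b)) (z * u b) := by
  obtain ⟨P, hP, hderiv⟩ := exists_jump_of_mem_operatorGraph hb.le hf
  set cl := z * contRep f (-b) with hcl
  set cr := z * contRep f b with hcr
  refine ⟨contRep f - impulseResponse ν b cl cr,
    P + jump b cl cr - impulseResponseDeriv ν b cl cr, ⟨?_, ?_⟩, ?_⟩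
  · exact ((isPrimitive_contRep hf.1.1).congr_ae hderiv).sub
      (isPrimitive_impulseResponse ν hb.le cl cr)
  · have key := hP.sub (isPrimitive_impulseResponseDeriv_sub_jump ν hb.le cl cr)
    rw [← sub_add] at key
    rw [add_sub_right_comm]
    refine key.congr_ae ?_
    filter_upwards [(contRep_spec hf.1.1).2, Lp.coeFn_add H (ν • f), Lp.coeFn_smul ν f]
      with x hrep hadd hsmul
    rw [Pi.sub_apply, Pi.sub_apply, hadd, Pi.add_apply, hsmul, Pi.smul_apply, hrep, smul_eq_mul]
    ring
  · rw [Pi.sub_apply, Pi.sub_apply, impulseResponse_left, impulseResponse_right ν hb, sub_zero,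
      sub_zero, ← hcl, ← hcr, sub_add_cancel, sub_add_cancel]
    exact ⟨rfl, hderiv⟩

theorem exists_mem_operatorGraph_of_memLp (hb : 0 < b) (hu : IsSolution ν H u v)
    (hF : MemLp (u + impulseResponse ν b (z * u (-b)) (z * u b)) 2)
    (hF' : MemLp (v + impulseResponseDeriv ν b (z * u (-b)) (z * u b)) 2)
    (hxF : MemLp ((fun x : ℝ => (x : ℂ)) * (u + impulseResponse ν b (z * u (-b)) (z * u b))) 2) :
    ∃ f, (f, H + ν • f) ∈ operatorGraph z b ∧
      contRep f = u + impulseResponse ν b (z * u (-b)) (z * u b) := by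
  set cl := z * u (-b) with hcl
  set cr := z * u b with hcr
  have hprim := (hu.isPrimitive.add (isPrimitive_impulseResponse ν hb.le cl cr)).congr_ae
    hF'.coeFn_toLp.symm
  have hrep : contRep hF.toLp = u + impulseResponse ν b cl cr :=
    contRep_eq hprim.continuous hF.coeFn_toLp
  have hweak : HasWeakDeriv hF.toLp hF'.toLp := hprim.hasWeakDeriv hF.coeFn_toLp
  have hmem : hF.toLp ∈ formDomain := ⟨⟨_, hweak⟩, hxF.ae_eq <| by
    filter_upwards [hF.coeFn_toLp] with x hx
    rw [hx, Pi.mul_apply]⟩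
  refine ⟨hF.toLp, mem_operatorGraph_of_jump hb.le hmem
    (P := v + (impulseResponseDeriv ν b cl cr - jump b cl cr)) ?_ ?_, hrep⟩
  · refine (hu.isPrimitive_deriv.add
      (isPrimitive_impulseResponseDeriv_sub_jump ν hb.le cl cr)).congr_ae ?_
    filter_upwards [hF.coeFn_toLp, Lp.coeFn_add H (ν • hF.toLp), Lp.coeFn_smul ν hF.toLp]
      with x hx hadd hsmul
    simp only [hrep, hadd, hsmul, hx, Pi.add_apply, Pi.smul_apply, smul_eq_mul]
    ring
  · rw [hweak.weakDeriv_eq, hrep, Pi.add_apply, Pi.add_apply, impulseResponse_left,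
      impulseResponse_right ν hb, add_zero, add_zero, ← hcl, ← hcr, add_assoc, sub_add_cancel]
    exact hF'.coeFn_toLp

/-! ### Matching at infinity -/

/-- The Wronskian at `r` of `D_ν` with the solution that continues `u` to the right of `b` across a
point interaction of strength `z`. If the source vanishes beyond `r`, then it is zero exactly
if this continuation decays at `+∞`. -/
def matchingDefect (z ν : ℂ) (b : ℝ) (u v : ℝ → ℂ) (r : ℝ) : ℂ :=
  wronskian u v (parabolicD ν) (parabolicDDeriv ν) r + z * u b * parabolicD ν b

/-- The matching defects at both ends of the line. Reflection at the origin turns the left end into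
the right one and changes the sign of `z`. -/
def matchingDefects (z ν : ℂ) (b : ℝ) (u v : ℝ → ℂ) (r : ℝ) : Fin 2 → ℂ :=
  ![matchingDefect z ν b u v r, matchingDefect (-z) ν b (fun x => u (-x)) (fun x => -v (-x)) r]

theorem wronskian_continuation (hbr : b ≤ r) :
    wronskian (u + fun x => z * u b * fundamentalSolution ν b x)
      (v + fun x => z * u b * fundamentalSolutionDeriv ν b x) (parabolicD ν) (parabolicDDeriv ν) r =
      matchingDefect z ν b u v r := by
  rw [matchingDefect, ← wronskian_fundamentalSolution ν b (parabolicD ν) (parabolicDDeriv ν),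
    ← (isSolution_fundamentalSolution ν b).wronskian_eq (isSolution_parabolicD ν)
      (.of_forall fun _ _ => rfl) hbr]
  simp only [wronskian, Pi.add_apply]
  ring

theorem continuation_comp_neg (z ν : ℂ) (b : ℝ) (u : ℝ → ℂ) :
    ((fun x => u (-x)) + fun x => -z * u (-b) * fundamentalSolution ν b x) =
      fun x => (u + fun x => z * u (-b) * fundamentalSolution ν (-b) x) (-x) := by
  ext x
  simp only [Pi.add_apply, fundamentalSolution_neg]
  ring

theorem continuationDeriv_comp_neg (z ν : ℂ) (b : ℝ) (u v : ℝ → ℂ) :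
    ((fun x => -v (-x)) + fun x => -z * u (-b) * fundamentalSolutionDeriv ν b x) =
      fun x => -(v + fun x => z * u (-b) * fundamentalSolutionDeriv ν (-b) x) (-x) := by
  ext x
  simp only [Pi.add_apply, fundamentalSolutionDeriv_neg]
  ring

theorem IsSolution.add_const_mul_fundamentalSolution {h : ℝ → ℂ} (hu : IsSolution ν h u v)
    (c : ℂ) (a : ℝ) :
    IsSolution ν h (u + fun x => c * fundamentalSolution ν a x)
      (v + fun x => c * fundamentalSolutionDeriv ν a x) :=
  hu.add_homogeneous ((isSolution_fundamentalSolution ν a).const_mul c)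

theorem ae_eq_zero_of_le {h : ℝ → ℂ} (hh : ∀ᵐ t, r ≤ |t| → h t = 0) :
    ∀ᵐ t, r ≤ t → h t = 0 :=
  hh.mono fun t ht hrt => ht (hrt.trans (le_abs_self t))

theorem ae_eq_zero_comp_neg {h : ℝ → ℂ} (hh : ∀ᵐ t, r ≤ |t| → h t = 0) :
    ∀ᵐ t, r ≤ |t| → h (-t) = 0 := by
  filter_upwards [(Measure.measurePreserving_neg (volume : Measure ℝ)).quasiMeasurePreserving.ae hh]
    with t ht hrt
  exact ht (by rwa [abs_neg])

theorem exists_mem_operatorGraph (hb : 0 < b) (hbr : b ≤ r) (hH : ∀ᵐ t, r ≤ |t| → H t = 0)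
    (hu : IsSolution ν H u v) (hdefects : matchingDefects z ν b u v r = 0) :
    ∃ f, (f, H + ν • f) ∈ operatorGraph z b ∧
      contRep f = u + impulseResponse ν b (z * u (-b)) (z * u b) := by
  have hR := hu.add_const_mul_fundamentalSolution (z * u b) b
  have hL := hu.add_const_mul_fundamentalSolution (z * u (-b)) (-b)
  obtain ⟨hRu, hRv⟩ := hR.rapidDecay (ae_eq_zero_of_le hH)
    ((wronskian_continuation hbr).trans (congrFun hdefects 0))
  obtain ⟨hLu, hLv⟩ := (hu.comp_neg.add_const_mul_fundamentalSolution (-z * u (-b)) b).rapidDecay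
    (ae_eq_zero_of_le (ae_eq_zero_comp_neg hH))
    ((wronskian_continuation hbr).trans (congrFun hdefects 1))
  rw [continuation_comp_neg] at hLu
  rw [continuationDeriv_comp_neg] at hLv
  have hLv' := hLv.const_mul (-1)
  simp only [neg_one_mul, neg_neg] at hLv'
  refine exists_mem_operatorGraph_of_memLp hb hu ?_ ?_ ?_
  · rw [impulseResponse, add_glue]
    exact memLp_glue b hL.isPrimitive.continuous (hu.isPrimitive.continuous.add continuous_zero)
      hR.isPrimitive.continuous hLu hRu
  · rw [impulseResponseDeriv, add_glue]
    exact memLp_glue b hL.isPrimitive_deriv.continuous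
      (hu.isPrimitive_deriv.continuous.add continuous_zero)
      hR.isPrimitive_deriv.continuous hLv' hRv
  · rw [impulseResponse, add_glue, mul_glue]
    refine memLp_glue b (Complex.continuous_ofReal.mul hL.isPrimitive.continuous)
      (Complex.continuous_ofReal.mul (hu.isPrimitive.continuous.add continuous_zero))
      (Complex.continuous_ofReal.mul hR.isPrimitive.continuous) ?_ hRu.param_mul
    refine (hLu.param_mul.const_mul (-1)).congr fun x => ?_
    simp only [Pi.mul_apply, Complex.ofReal_neg]
    ring

theorem matchingDefect_eq_zero_of_memLp {h F F' : ℝ → ℂ} (hbr : b ≤ r)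
    (hh : ∀ᵐ t, r ≤ t → h t = 0) (hu : IsSolution ν h u v) (hF : MemLp F 2) (hF' : MemLp F' 2)
    (hFu : ∀ᵐ x, b < x → F x = u x + z * u b * fundamentalSolution ν b x)
    (hFv : ∀ᵐ x, b < x → F' x = v x + z * u b * fundamentalSolutionDeriv ν b x) :
    matchingDefect z ν b u v r = 0 := by
  rw [← wronskian_continuation hbr]
  refine (hu.add_const_mul_fundamentalSolution (z * u b) b).wronskian_parabolicD_eq_zero
    hh ((hF.restrict _).ae_eq ?_) ((hF'.restrict _).ae_eq ?_)
  · filter_upwards [ae_restrict_of_ae hFu, ae_restrict_mem measurableSet_Ioi] with x hx hrx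
    exact hx (hbr.trans_lt hrx)
  · filter_upwards [ae_restrict_of_ae hFv, ae_restrict_mem measurableSet_Ioi] with x hx hrx
    exact hx (hbr.trans_lt hrx)

theorem exists_isSolution_of_mem_operatorGraph_of_ae_eq_zero (hb : 0 < b) (hbr : b ≤ r)
    (hH : ∀ᵐ t, r ≤ |t| → H t = 0) (hf : (f, H + ν • f) ∈ operatorGraph z b) :
    ∃ u v, IsSolution ν H u v ∧ contRep f = u + impulseResponse ν b (z * u (-b)) (z * u b) ∧
      matchingDefects z ν b u v r = 0 := by
  obtain ⟨u, v, hu, hrep, hderiv⟩ := exists_isSolution_of_mem_operatorGraph hb hf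
  have hF : MemLp (contRep f) 2 := memLp_contRep hf.1.1
  have hF' : MemLp (weakDeriv f) 2 := Lp.memLp _
  have hneg := Measure.measurePreserving_neg (volume : Measure ℝ)
  refine ⟨u, v, hu, hrep, funext (Fin.forall_fin_two.2 ⟨?_, ?_⟩)⟩
  · refine matchingDefect_eq_zero_of_memLp hbr (ae_eq_zero_of_le hH) hu hF hF' ?_ ?_
    · refine .of_forall fun x hx => ?_
      rw [hrep, Pi.add_apply, impulseResponse, glue_of_lt _ _ _ hb.le hx]
    · filter_upwards [hderiv] with x hx hbx
      rw [hx, Pi.add_apply, impulseResponseDeriv, glue_of_lt _ _ _ hb.le hbx]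
  · refine matchingDefect_eq_zero_of_memLp hbr (ae_eq_zero_of_le (ae_eq_zero_comp_neg hH))
      hu.comp_neg (hF.comp_measurePreserving hneg) (hF'.comp_measurePreserving hneg).neg ?_ ?_
    · refine .of_forall fun x hx => ?_
      have hx' : -x ≤ -b := neg_le_neg hx.le
      have := congrFun (continuation_comp_neg z ν b u) x
      rw [Function.comp_apply, hrep, Pi.add_apply, impulseResponse, glue_of_le _ _ _ hx']
      exact this.symm
    · filter_upwards [hneg.quasiMeasurePreserving.ae hderiv] with x hx hbx
      have hx' : -x ≤ -b := neg_le_neg hbx.le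
      have := congrFun (continuationDeriv_comp_neg z ν b u v) x
      rw [Pi.neg_apply, Function.comp_apply, hx, Pi.add_apply, impulseResponseDeriv,
        glue_of_le _ _ _ hx']
      exact this.symm

end PointInteraction

/-- The matrix that sends the coefficients of `α * yEven ν + β * yOdd ν` to its matching
defects. -/
def matchingMatrix (z ν : ℂ) (b : ℝ) : Matrix (Fin 2) (Fin 2) ℂ :=
  !![oddCoeff ν + z * parabolicD ν b * yEven ν b, evenCoeff ν + z * parabolicD ν b * yOdd ν b;
    oddCoeff ν - z * parabolicD ν b * yEven ν b, -(evenCoeff ν - z * parabolicD ν b * yOdd ν b)]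

theorem det_matchingMatrix (z ν : ℂ) (b : ℝ) :
    (matchingMatrix z ν b).det = -2 * (evenCoeff ν * oddCoeff ν -
      z ^ 2 * parabolicD ν b ^ 2 * yEven ν b * yOdd ν b) := by
  rw [matchingMatrix, Matrix.det_fin_two_of]
  ring

theorem det_matchingMatrix_eq_zero_iff (z ν : ℂ) (b : ℝ) :
    (matchingMatrix z ν b).det = 0 ↔ evenCoeff ν * oddCoeff ν -
      z ^ 2 * parabolicD ν b ^ 2 * yEven ν b * yOdd ν b = 0 := by
  rw [det_matchingMatrix, mul_eq_zero_iff_left (by norm_num)]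

theorem matchingDefect_linearCombination (z ν α β : ℂ) (b r : ℝ) :
    matchingDefect z ν b (fun x => α * yEven ν x + β * yOdd ν x)
        (fun x => α * yEvenDeriv ν x + β * yOddDeriv ν x) r =
      (oddCoeff ν + z * parabolicD ν b * yEven ν b) * α +
        (evenCoeff ν + z * parabolicD ν b * yOdd ν b) * β := by
  have hE := wronskian_yEven_parabolicD ν r
  have hO := wronskian_yOdd_parabolicD ν r
  simp only [wronskian] at hE hO
  simp only [matchingDefect, wronskian]
  linear_combination α * hE + β * hO

theorem matchingDefects_linearCombination (z ν : ℂ) (b r : ℝ) (c : Fin 2 → ℂ) :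
    matchingDefects z ν b (fun x => c 0 * yEven ν x + c 1 * yOdd ν x)
      (fun x => c 0 * yEvenDeriv ν x + c 1 * yOddDeriv ν x) r =
        (matchingMatrix z ν b).mulVec c := by
  have hright := matchingDefect_linearCombination z ν (c 0) (c 1) b r
  have hleft := matchingDefect_linearCombination (-z) ν (c 0) (-c 1) b r
  simp only [matchingDefect, wronskian] at hleft
  refine funext (Fin.forall_fin_two.2 ⟨?_, ?_⟩)
  · rw [matchingMatrix, Matrix.mulVec, Matrix.vec2_dotProduct]
    exact hright
  · rw [matchingMatrix, Matrix.mulVec, Matrix.vec2_dotProduct]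
    simp only [matchingDefects, matchingDefect, wronskian, Matrix.cons_val_one, Matrix.of_apply,
      Matrix.cons_val_zero, Matrix.cons_val', Matrix.cons_val_fin_one, Complex.ofReal_neg,
      yEven_neg, yOdd_neg, yEvenDeriv_neg, yOddDeriv_neg]
    linear_combination hleft

theorem matchingDefects_add (z ν : ℂ) (b r : ℝ) (u v w w' : ℝ → ℂ) :
    matchingDefects z ν b (u + w) (v + w') r =
      matchingDefects z ν b u v r + matchingDefects z ν b w w' r := by
  refine funext (Fin.forall_fin_two.2 ⟨?_, ?_⟩) <;>
  · simp only [matchingDefects, matchingDefect, wronskian, Pi.add_apply, Matrix.cons_val_zero,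
      Matrix.cons_val_one]
    ring

section Matching

variable {z ν : ℂ} {b : ℝ}

theorem exists_isSolution_matchingDefects_eq_zero (hdet : (matchingMatrix z ν b).det ≠ 0)
    {h : ℝ → ℂ} (hh : LocallyIntegrable h) (r : ℝ) :
    ∃ u v, IsSolution ν h u v ∧ matchingDefects z ν b u v r = 0 := by
  obtain ⟨u, v, hu⟩ := exists_isSolution ν hh
  obtain ⟨c, hc⟩ := Matrix.mulVec_surjective_iff_isUnit.2
    ((Matrix.isUnit_iff_isUnit_det _).2 hdet.isUnit) (-matchingDefects z ν b u v r)
  refine ⟨_, _, hu.add_homogeneous (isSolution_linearCombination ν (c 0) (c 1)), ?_⟩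
  rw [matchingDefects_add, matchingDefects_linearCombination, hc, add_neg_cancel]

theorem impulseResponse_zero (ν : ℂ) (b : ℝ) : impulseResponse ν b 0 0 = 0 := by
  ext x
  simp [impulseResponse, glue, Set.piecewise]

theorem isSolution_coeFn_zero_iff {u v : ℝ → ℂ} :
    IsSolution ν (0 : L2) u v ↔ IsSolution ν 0 u v :=
  ⟨fun hu => hu.congr_ae (Lp.coeFn_zero ℂ 2 volume),
    fun hu => hu.congr_ae (Lp.coeFn_zero ℂ 2 volume).symm⟩

theorem ae_coeFn_zero (r : ℝ) : ∀ᵐ t, r ≤ |t| → (0 : L2) t = 0 :=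
  (Lp.coeFn_zero ℂ 2 volume).mono fun _ ht _ => ht

theorem contRep_zero : contRep (0 : L2) = 0 :=
  contRep_eq continuous_zero (Lp.coeFn_zero ℂ 2 volume)

theorem exists_eigenfunction (hb : 0 < b) (hdet : (matchingMatrix z ν b).det = 0) :
    ∃ f : L2, f ≠ 0 ∧ (f, ν • f) ∈ operatorGraph z b := by
  obtain ⟨c, hc, hMc⟩ := Matrix.exists_mulVec_eq_zero_iff.2 hdet
  rw [← matchingDefects_linearCombination z ν b b] at hMc
  obtain ⟨f, hf, hrep⟩ := exists_mem_operatorGraph hb le_rfl (ae_coeFn_zero b)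
    (isSolution_coeFn_zero_iff.2 (isSolution_linearCombination ν (c 0) (c 1))) hMc
  rw [zero_add] at hf
  refine ⟨f, fun hf0 => hc ?_, hf⟩
  rw [hf0, contRep_zero] at hrep
  have hleft := congrFun hrep (-b)
  have hright := congrFun hrep b
  rw [Pi.add_apply, impulseResponse_left, add_zero, Pi.zero_apply] at hleft
  rw [Pi.add_apply, impulseResponse_right ν hb, add_zero, Pi.zero_apply] at hright
  rw [← hleft, ← hright, mul_zero, impulseResponse_zero, add_zero] at hrep
  obtain ⟨h0, h1⟩ := eq_zero_of_linearCombination_eq_zero hrep.symm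
  ext i
  fin_cases i
  exacts [h0, h1]

theorem eq_zero_of_mem_operatorGraph (hb : 0 < b) (hdet : (matchingMatrix z ν b).det ≠ 0) {f : L2}
    (hf : (f, ν • f) ∈ operatorGraph z b) : f = 0 := by
  rw [← zero_add (ν • f)] at hf
  obtain ⟨u, v, hu, hrep, hdefects⟩ :=
    exists_isSolution_of_mem_operatorGraph_of_ae_eq_zero hb le_rfl (ae_coeFn_zero b) hf
  obtain ⟨α, β, rfl, rfl⟩ := (isSolution_coeFn_zero_iff.1 hu).exists_eq_linearCombination
  have hc : ![α, β] = 0 := Matrix.eq_zero_of_mulVec_eq_zero hdet <|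
    (matchingDefects_linearCombination z ν b b ![α, β]).symm.trans hdefects
  obtain ⟨rfl, rfl⟩ : α = 0 ∧ β = 0 := by simpa using hc
  have hrep_zero : contRep f = 0 := by
    ext x
    simp [hrep, impulseResponse_zero]
  refine Lp.ext ((contRep_spec hf.1.1).2.trans ?_)
  rw [hrep_zero]
  exact (Lp.coeFn_zero ℂ 2 volume).symm

end Matching

/-! ### The spectrum -/

section Resolvent

open Filter Topology

variable {E : Type*} [NormedAddCommGroup E] [NormedSpace ℂ E] {A : E →ₗ.[ℂ] E} {ν : ℂ}

theorem notMem_resolventSet_of_mem_graph {f : E} (hf : f ≠ 0) (hA : (f, ν • f) ∈ A.graph) :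
    ν ∉ resolventSet A := by
  rintro ⟨R, -, hR⟩
  obtain ⟨y, rfl, hy⟩ := (A.mem_graph_iff).1 hA
  have := hR y
  rw [hy, sub_self, map_zero] at this
  exact hf this.symm

theorem mem_resolventSet_of_existsUnique [CompleteSpace E] (hA : A.IsClosed)
    (hex : ∀ h, ∃! f, (f, h + ν • f) ∈ A.graph) : ν ∈ resolventSet A := by
  choose R hR huniq using hex
  let Rlin : E →ₗ[ℂ] E :=
    { toFun := R
      map_add' := fun h k => (huniq _ _ <| by
        convert! A.graph.add_mem (hR h) (hR k) using 1
        rw [Prod.mk_add_mk, smul_add, add_add_add_comm]).symm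
      map_smul' := fun c h => (huniq _ _ <| by
        convert! A.graph.smul_mem c (hR h) using 1
        rw [Prod.smul_mk, smul_add, RingHom.id_apply, smul_comm ν c]).symm }
  have hclosed (u : ℕ → E) (x y : E) (hu : Tendsto u atTop (𝓝 x))
      (hy : Tendsto (Rlin ∘ u) atTop (𝓝 y)) : y = Rlin x :=
    huniq x y <| IsClosed.mem_of_tendsto hA (hy.prodMk_nhds (hu.add (hy.const_smul ν)))
      (.of_forall fun n => hR (u n))
  refine ⟨.ofSeqClosedGraph hclosed, fun h => ?_, fun f => (huniq _ _ ?_).symm⟩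
  · obtain ⟨⟨f, hf⟩, rfl, hAf⟩ := (A.mem_graph_iff).1 (hR h)
    exact ⟨hf, sub_eq_iff_eq_add.2 hAf⟩
  · simpa only [sub_add_cancel] using A.mem_graph f

end Resolvent

variable {z ν : ℂ} {b : ℝ}

theorem IsPerturbedResolvent.mem_operatorGraph_iff {K S : L2 →L[ℂ] L2}
    (hS : IsPerturbedResolvent z b ν K S) {f h : L2} :
    (f, h) ∈ operatorGraph z b ↔ f = S (h - ν • f + K f) := by
  refine ⟨hS.eq_apply, fun hf => ?_⟩
  have := hS.mem_operatorGraph (h - ν • f + K f)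
  rw [← hf] at this
  convert! this using 2
  abel

theorem isClosed_pcOperator (z : ℂ) (b : ℝ) : (pcOperator z b).IsClosed := by
  obtain ⟨-, -, K, S, -, hS⟩ := exists_isPerturbedResolvent z b 0
  rw [LinearPMap.IsClosed, pcOperator_graph]
  have : (operatorGraph z b : Set (L2 × L2)) =
      {p | p.1 = S (p.2 - (0 : ℂ) • p.1 + K p.1)} := Set.ext fun _ => hS.mem_operatorGraph_iff
  rw [this]
  exact isClosed_eq continuous_fst (by fun_prop)

theorem exists_mem_operatorGraph_of_hasCompactSupport (hb : 0 < b)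
    (hdet : (matchingMatrix z ν b).det ≠ 0) {χ : ℝ → ℝ} (hχ : HasCompactSupport χ) {h f : L2}
    (hh : h =ᵐ[volume] fun x => (χ x : ℂ) * f x) :
    ∃ g, (g, h + ν • g) ∈ operatorGraph z b := by
  obtain ⟨R, -, hR⟩ := hχ.exists_pos_le_norm
  obtain ⟨u, v, hu, hdefects⟩ :=
    exists_isSolution_matchingDefects_eq_zero hdet (L2.locallyIntegrable h) (max R b)
  obtain ⟨g, hg, -⟩ := exists_mem_operatorGraph hb (le_max_right R b)
    (by
      filter_upwards [hh] with t ht hrt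
      rw [ht, hR t ((le_max_left R b).trans hrt), Complex.ofReal_zero, zero_mul]) hu hdefects
  exact ⟨g, hg⟩

theorem existsUnique_mem_operatorGraph (hb : 0 < b) (hdet : (matchingMatrix z ν b).det ≠ 0)
    (h : L2) : ∃! f, (f, h + ν • f) ∈ operatorGraph z b := by
  obtain ⟨χ, hχ, K, S, hK, hS⟩ := exists_isPerturbedResolvent z b ν
  obtain ⟨g, hg⟩ := exists_mem_operatorGraph_of_hasCompactSupport hb hdet hχ (hK (S h))
  have hmem : (S h + g, h + ν • (S h + g)) ∈ operatorGraph z b := by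
    convert! (operatorGraph z b).add_mem (hS.mem_operatorGraph h) hg using 1
    rw [Prod.mk_add_mk, smul_add]
    congr 1
    abel
  refine ⟨S h + g, hmem, fun f hf => sub_eq_zero.1 (eq_zero_of_mem_operatorGraph hb hdet ?_)⟩
  convert! (operatorGraph z b).sub_mem hf hmem using 1
  rw [Prod.mk_sub_mk, add_sub_add_left_eq_sub, smul_sub]

theorem mem_opSpectrum_pcOperator_iff (hb : 0 < b) :
    ν ∈ opSpectrum (pcOperator z b) ↔ (matchingMatrix z ν b).det = 0 := by
  refine ⟨fun hν => ?_, fun hdet => ?_⟩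
  · by_contra hdet
    refine hν (mem_resolventSet_of_existsUnique (isClosed_pcOperator z b) ?_)
    rw [pcOperator_graph]
    exact existsUnique_mem_operatorGraph hb hdet
  · obtain ⟨f, hf_ne, hf⟩ := exists_eigenfunction hb hdet
    rw [← pcOperator_graph] at hf
    exact notMem_resolventSet_of_mem_graph hf_ne hf

end

end OddPair

theorem mainTheorem2 (z : ℂ) (b : ℝ) (hb : 0 < b) (ν : ℂ) :
    ν ∈ OddPair.opSpectrum (OddPair.pcOperator z b) ↔
      (√Real.pi : ℂ) / (√2 : ℂ) * OddPair.recipGamma (-ν)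
        - z ^ 2 * OddPair.parabolicD ν b ^ 2 * OddPair.yEven ν b * OddPair.yOdd ν b = 0 := by
  rw [OddPair.mem_opSpectrum_pcOperator_iff hb, OddPair.det_matchingMatrix_eq_zero_iff,
    OddPair.evenCoeff_mul_oddCoeff]
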